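/- Let $\mathcal M$ be an oriented matroid on a finite ground set $\{1,\dots,n,f\}$ in which $f$ is not a loop (so $(\mathcal M,f)$ is an affine oriented matroid), let $\mathcal M^*$ be its dual and let ${}_{-f}\mathcal M^*$ be $\mathcal M^*$ with the element $f$ reoriented. For an oriented matroid $\mathcal N$ on $\{1,\dots,n\}$ let $\Lambda(\mathcal N)=(\mathcal N^*\cup(-\mathcal N^*))^*$ be its Lawrence oriented matroid on $\{x_1,\dots,x_n,y_1,\dots,y_n\}$, where $\mathcal N^*\cup(-\mathcal N^*)$ is obtained from $\mathcal N^*$ by naming the $i$-th element $x_i$ and adjoining an element $y_i$ opposite to each $x_i$. For an oriented matroid $\mathcal M'$ on $\{1,\dots,n,f\}$ let $S(\mathcal M',f)$ be the collection of the sets $$\{x_i : i\notin C^+\}\cup\{y_i : i\notin C^-\},$$ where $C=(C^+,C^-)$ runs over all signed cocircuits of $\mathcal M'$ with $f\in C^+$; regard it also as the simplicial complex on $V=\{x_1,\dots,x_n,y_1,\dots,y_n\}$ generated by these sets. A lifting subdivision of an oriented matroid $\mathcal N$ is a subdivision of $\mathcal N$ whose maximal cells are the sets $\{e : e\notin C^+\}$,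 where $C$ runs over the positive cocircuits with $f\in C^+$ of some oriented matroid $\mathcal L$ with one additional element $f$ such that $\mathcal L/f=\mathcal N$ and $f$ belongs to some positive cocircuit of $\mathcal L$. The Alexander dual of a simplicial complex $K$ on $V$ is $K^\vee=\{V\setminus\sigma : \sigma\subseteq V,\ \sigma\notin K\}$ (the complex without any face is allowed). Then $S(\mathcal M,f)$ is a lifting subdivision of $\Lambda(\mathcal M/f)$; if $f$ is not a loop of $\mathcal M^*$, so that $({}_{-f}\mathcal M^*,f)$ is an affine oriented matroid as well, then $S({}_{-f}\mathcal M^*,f)$ is a lifting subdivision of $\Lambda(\mathcal M^*/f)$; and the two simplicial complexes are Alexander dual to one another: $$S(\mathcal M,f)^\vee=S({}_{-f}\mathcal M^*,f),\qquad S({}_{-f}\mathcal M^*,f)^\vee=S(\mathcal M,f).$$ -/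

import Mathlib

/-- Composition `X ∘ Y` of sign vectors. -/
def SignVec.comp {E : Type*} (X Y : E → SignType) : E → SignType :=
  fun e => if X e = 0 then Y e else X e

/-- Orthogonality of sign vectors: either the supports are disjoint, or there are both a common
element where the signs agree and a common element where they disagree. -/
def SignVec.Orth {E : Type*} (X Y : E → SignType) : Prop :=
  (∃ e, X e * Y e = 1) ↔ (∃ e, X e * Y e = -1)

/-- An oriented matroid on `E` (finite in all uses), given by its set of covectors, subject to the
standard covector axioms. -/
@[ext]
structure OrientedMatroid (E : Type*) where
  covectors : Set (E → SignType)
  zero_mem : 0 ∈ covectors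
  neg_mem : ∀ X ∈ covectors, -X ∈ covectors
  comp_mem : ∀ X ∈ covectors, ∀ Y ∈ covectors, SignVec.comp X Y ∈ covectors
  elim : ∀ X ∈ covectors, ∀ Y ∈ covectors, ∀ e, X e * Y e = -1 →
    ∃ Z ∈ covectors, Z e = 0 ∧ ∀ g, X g * Y g ≠ -1 → Z g = SignVec.comp X Y g

namespace SignVec

variable {E : Type*}

theorem orth_symm {X Y : E → SignType} (h : Orth X Y) : Orth Y X := by
  simpa [Orth, mul_comm] using h

theorem orth_neg {X Y : E → SignType} (h : Orth X Y) : Orth X (-Y) := by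
  have aux : ∀ a b : SignType, (a * -b = 1 ↔ a * b = -1) ∧ (a * -b = -1 ↔ a * b = 1) := by decide
  have h1 : ∀ e, (X e * (-Y) e = 1 ↔ X e * Y e = -1) := fun e => (aux _ _).1
  have h2 : ∀ e, (X e * (-Y) e = -1 ↔ X e * Y e = 1) := fun e => (aux _ _).2
  unfold Orth at *
  simp only [h1, h2]
  exact h.symm

theorem orth_comp {X Y Z : E → SignType} (hY : Orth X Y) (hZ : Orth X Z) :
    Orth X (comp Y Z) := by
  have aux : ∀ e, Y e ≠ 0 → comp Y Z e = Y e := fun e h => by simp [comp, h]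
  have aux' : ∀ e, X e * Y e = 0 → X e * comp Y Z e = X e * Z e := by
    intro e h
    unfold comp
    rcases mul_eq_zero.1 h with h | h <;> simp [h]
  have key : ∀ e (s : SignType), s ≠ 0 → X e * Y e = s → X e * comp Y Z e = s := by
    intro e s hs h
    rw [aux e (by rintro h0; rw [h0, mul_zero] at h; exact hs h.symm)]
    exact h
  have tri : ∀ s : SignType, s = 0 ∨ s = 1 ∨ s = -1 := by decide
  by_cases hp : ∃ e, X e * Y e = 1
  · obtain ⟨e, he⟩ := hp
    obtain ⟨e', he'⟩ := hY.1 ⟨e, he⟩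
    exact ⟨fun _ => ⟨e', key e' _ (by decide) he'⟩, fun _ => ⟨e, key e _ (by decide) he⟩⟩
  · have hn : ¬ ∃ e, X e * Y e = -1 := fun h => hp (hY.2 h)
    have h0 : ∀ e, X e * Y e = 0 := by
      intro e
      rcases tri (X e * Y e) with h | h | h
      · exact h
      · exact (hp ⟨e, h⟩).elim
      · exact (hn ⟨e, h⟩).elim
    unfold Orth
    simp only [aux' _ (h0 _)]
    exact hZ

theorem comp_neg (X Y : E → SignType) (e : E) : comp (-X) (-Y) e = -comp X Y e := by
  simp only [comp, Pi.neg_apply]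
  generalize X e = a
  generalize Y e = b
  revert a b
  decide

/-- A way to refute orthogonality. -/
theorem not_orth {X Y : E → SignType} (e : E) (he : X e * Y e = 1)
    (h : ∀ g, X g * Y g ≠ -1) : ¬ Orth X Y := by
  intro ho
  obtain ⟨g, hg⟩ := ho.1 ⟨e, he⟩
  exact h g hg

theorem exists_of_not_orth {X Y : E → SignType} (h : ¬ Orth X Y) :
    ((∃ e, X e * Y e = 1) ∧ ∀ g, X g * Y g ≠ -1) ∨
      ((∃ e, (-X) e * Y e = 1) ∧ ∀ g, (-X) g * Y g ≠ -1) := by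
  have aux : ∀ a b : SignType, (-a * b = 1 ↔ a * b = -1) ∧ (-a * b = -1 ↔ a * b = 1) := by decide
  simp only [Pi.neg_apply, (aux _ _).1, ne_eq, (aux _ _).2]
  unfold Orth at h
  by_cases h1 : ∃ e, X e * Y e = 1
  · left
    exact ⟨h1, fun g hg => h ⟨fun _ => ⟨g, hg⟩, fun _ => h1⟩⟩
  · right
    by_cases h2 : ∃ e, X e * Y e = -1
    · exact ⟨h2, fun g hg => h1 ⟨g, hg⟩⟩
    · exact (h ⟨fun a => (h1 a).elim, fun a => (h2 a).elim⟩).elim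

end SignVec

namespace OrientedMatroid

open SignVec

variable {E : Type*}

/-- A sign vector orthogonal to all covectors vanishing at `g` can be changed at `g` so that it
becomes orthogonal to all covectors. -/
theorem exists_update_orth [DecidableEq E] (M : OrientedMatroid E) (g : E) (Y : E → SignType)
    (hY : ∀ X ∈ M.covectors, X g = 0 → Orth X Y) :
    ∃ s, ∀ X ∈ M.covectors, Orth X (Function.update Y g s) := by
  have sgn : ∀ s : SignType, ¬ (∀ X ∈ M.covectors, Orth X (Function.update Y g s)) →
      ∃ X ∈ M.covectors, (∃ e, X e * Function.update Y g s e = 1) ∧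
        ∀ e, X e * Function.update Y g s e ≠ -1 := by
    intro s h
    push Not at h
    obtain ⟨X, hX, hXs⟩ := h
    rcases exists_of_not_orth hXs with h | h
    · exact ⟨X, hX, h⟩
    · exact ⟨-X, M.neg_mem X hX, h⟩
  have vanish : ∀ (X : E → SignType) (s : SignType), X ∈ M.covectors →
      (∃ e, X e * Function.update Y g s e = 1) → (∀ e, X e * Function.update Y g s e ≠ -1) →
      X g ≠ 0 := by
    intro X s hX ⟨e, he⟩ hn h0
    refine not_orth (Y := Y) e ?_ ?_ (hY X hX h0)
    · have : e ≠ g := by rintro rfl; simp [h0] at he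
      simpa [this] using he
    · intro k
      by_cases hk : k = g
      · subst hk; simp [h0]
      · simpa [hk] using hn k
  by_contra hcon
  push Not at hcon
  have hcon' : ∀ s, ¬ (∀ X ∈ M.covectors, Orth X (Function.update Y g s)) := by
    intro s h
    obtain ⟨X, hX, h'⟩ := hcon s
    exact h' (h X hX)
  obtain ⟨X, hX, hX1, hX2⟩ := sgn 0 (hcon' 0)
  have hXg := vanish X 0 hX hX1 hX2
  obtain ⟨W, hW, hW1, hW2⟩ := sgn (-X g) (hcon' _)
  have hWg := vanish W _ hW hW1 hW2
  have hWXg : X g * W g = -1 := by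
    have := hW2 g
    simp only [Function.update_self] at this
    revert this hXg hWg
    generalize X g = a
    generalize W g = b
    revert a b
    decide
  obtain ⟨Z, hZ, hZg, hZc⟩ := M.elim X hX W hW g hWXg
  have aux : ∀ a b y z : SignType, a * y ≠ -1 → b * y ≠ -1 →
      (a * b ≠ -1 → z = if a = 0 then b else a) →
        z * y ≠ -1 ∧ (a * y = 1 → z * y = 1) := by decide
  obtain ⟨e, he⟩ := hX1
  have hall : ∀ k, k ≠ g → Z k * Y k ≠ -1 ∧ (X k * Y k = 1 → Z k * Y k = 1) := by
    intro k hk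
    refine aux (X k) (W k) (Y k) (Z k) ?_ ?_ (hZc k)
    · simpa [hk] using hX2 k
    · simpa [hk] using hW2 k
  have heg : e ≠ g := by rintro rfl; simp at he
  refine not_orth (X := Z) (Y := Y) e ((hall e heg).2 (by simpa [heg] using he)) ?_
    (hY Z hZ hZg)
  intro k
  by_cases hk : k = g
  · subst hk; simp [hZg]
  · exact (hall k hk).1

theorem painting_aux [DecidableEq E] (e : E) (T : Finset E) :
    ∀ (M : OrientedMatroid E) (p q : E → Prop), e ∉ T →
      (∀ X ∈ M.covectors, ∀ g, g ∉ T → g ≠ e → X g = 0) →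
      (∃ Z ∈ M.covectors, Z e = 1 ∧ ∀ g, g ≠ e → (Z g = 1 → p g) ∧ (Z g = -1 → q g)) ∨
      (∃ Y : E → SignType, (∀ X ∈ M.covectors, Orth X Y) ∧ Y e = 1 ∧
        ∀ g, g ≠ e → (Y g = 1 → ¬ q g) ∧ (Y g = -1 → ¬ p g)) := by
  have tri : ∀ s : SignType, s = 0 ∨ s = 1 ∨ s = -1 := by decide
  induction T using Finset.induction_on with
  | empty =>
    intro M p q _ hs
    by_cases h : ∃ Z ∈ M.covectors, Z e ≠ 0
    · left
      obtain ⟨Z, hZ, hZe⟩ := h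
      obtain ⟨Z', hZ', hZe'⟩ : ∃ Z' ∈ M.covectors, Z' e = 1 := by
        rcases tri (Z e) with h | h | h
        · exact (hZe h).elim
        · exact ⟨Z, hZ, h⟩
        · exact ⟨-Z, M.neg_mem Z hZ, by simp [h]⟩
      exact ⟨Z', hZ', hZe', fun g hg => by simp [hs Z' hZ' g (by simp) hg]⟩
    · right
      push Not at h
      refine ⟨fun g => if g = e then 1 else 0, ?_, by simp, fun g hg => by simp [hg]⟩
      intro X hX
      have : ∀ g, X g = 0 := fun g => by
        by_cases hg : g = e
        · rw [hg]; exact h X hX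
        · exact hs X hX g (by simp) hg
      simp [Orth, this]
  | insert g T hgT ih =>
    intro M p q heT hs
    have heg : e ≠ g := fun h => heT (by simp [h])
    have heT' : e ∉ T := fun h => heT (by simp [h])
    let D : OrientedMatroid E :=
      { covectors := {X | X ∈ M.covectors ∧ X g = 0}
        zero_mem := ⟨M.zero_mem, rfl⟩
        neg_mem := fun X hX => ⟨M.neg_mem X hX.1, by simp [hX.2]⟩
        comp_mem := fun X hX Y hY => ⟨M.comp_mem X hX.1 Y hY.1, by simp [comp, hX.2, hY.2]⟩
        elim := fun X hX Y hY k hk => by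
          obtain ⟨Z, hZ, h0, h1⟩ := M.elim X hX.1 Y hY.1 k hk
          refine ⟨Z, ⟨hZ, ?_⟩, h0, h1⟩
          rw [h1 g (by simp [hX.2])]
          simp [comp, hX.2, hY.2] }
    let K : OrientedMatroid E :=
      { covectors := {X | ∃ X' ∈ M.covectors, X = Function.update X' g 0}
        zero_mem := ⟨0, M.zero_mem, by ext k; by_cases h : k = g <;> simp [h]⟩
        neg_mem := by
          rintro _ ⟨X, hX, rfl⟩
          exact ⟨-X, M.neg_mem X hX, by ext k; by_cases h : k = g <;> simp [h]⟩
        comp_mem := by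
          rintro _ ⟨X, hX, rfl⟩ _ ⟨Y, hY, rfl⟩
          exact ⟨comp X Y, M.comp_mem X hX Y hY, by
            ext k; by_cases h : k = g <;> simp [comp, h]⟩
        elim := by
          rintro _ ⟨X, hX, rfl⟩ _ ⟨Y, hY, rfl⟩ k hk
          have hkg : k ≠ g := by rintro rfl; simp at hk
          obtain ⟨Z, hZ, h0, h1⟩ := M.elim X hX Y hY k (by simpa [hkg] using hk)
          refine ⟨_, ⟨Z, hZ, rfl⟩, by simp [hkg, h0], fun l hl => ?_⟩
          by_cases h : l = g
          · subst h; simp [comp]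
          · simp only [ne_eq, h, not_false_eq_true, Function.update_of_ne] at hl
            simpa [comp, h] using h1 l hl }
    have hK := ih K p q heT' (by
      rintro _ ⟨X, hX, rfl⟩ k hk hke
      by_cases h : k = g
      · simp [h]
      · simpa [h] using hs X hX k (by simp [h, hk]) hke)
    have hD := ih D p q heT' (by
      rintro X ⟨hX, hXg⟩ k hk hke
      by_cases h : k = g
      · rw [h]; exact hXg
      · exact hs X hX k (by simp [h, hk]) hke)
    rcases hD with ⟨Z, hZ, hZe, hZp⟩ | ⟨Y, hY, hYe, hYp⟩
    · exact Or.inl ⟨Z, hZ.1, hZe, hZp⟩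
    rcases hK with ⟨_, ⟨Z, hZ, rfl⟩, hZe, hZp⟩ | ⟨Y', hY', hYe', hYp'⟩
    swap
    · right
      refine ⟨Function.update Y' g 0, fun X hX => ?_, by simpa [heg] using hYe', fun k hk => ?_⟩
      · have h1 := hY' _ ⟨X, hX, rfl⟩
        have : ∀ k, X k * Function.update Y' g 0 k = Function.update X g 0 k * Y' k := by
          intro k; by_cases h : k = g <;> simp [h]
        simpa only [Orth, this] using h1
      · by_cases h : k = g
        · simp [h]
        · simpa [h] using hYp' k hk
    obtain ⟨s, hs'⟩ := M.exists_update_orth g Y (fun X hX hXg => hY X ⟨hX, hXg⟩)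
    rw [Function.update_of_ne heg] at hZe
    have hZp' : ∀ k, k ≠ e → k ≠ g → (Z k = 1 → p k) ∧ (Z k = -1 → q k) := by
      intro k hk hkg
      simpa [hkg] using hZp k hk
    by_cases hsg : (s = 1 → ¬ q g) ∧ (s = -1 → ¬ p g)
    · right
      refine ⟨_, hs', by simpa [heg] using hYe, fun k hk => ?_⟩
      by_cases h : k = g
      · subst h; simpa using hsg
      · simpa [h] using hYp k hk
    by_cases hZg : (Z g = 1 → p g) ∧ (Z g = -1 → q g)
    · left
      refine ⟨Z, hZ, hZe, fun k hk => ?_⟩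
      by_cases h : k = g
      · subst h; exact hZg
      · exact hZp' k hk h
    exfalso
    have mulneg : ∀ a b : SignType, a * b = -1 → (a = 1 ∧ b = -1) ∨ (a = -1 ∧ b = 1) := by decide
    refine not_orth (X := Z) e ?_ ?_ (hs' Z hZ)
    · simp [heg, hZe, hYe]
    · intro k hk
      rcases mulneg _ _ hk with ⟨h1, h2⟩ | ⟨h1, h2⟩
      · by_cases hke : k = e
        · subst hke; simp [heg, hYe] at h2
        · by_cases h : k = g
          · subst h
            simp only [Function.update_self] at h2
            subst h2
            simp only [h1] at hZg
            simp at hsg hZg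
            exact hZg hsg
          · simp only [ne_eq, h, not_false_eq_true, Function.update_of_ne] at h2
            exact (hYp k hke).2 h2 ((hZp' k hke h).1 h1)
      · by_cases hke : k = e
        · subst hke; simp [hZe] at h1
        · by_cases h : k = g
          · subst h
            simp only [Function.update_self] at h2
            subst h2
            simp only [h1] at hZg
            simp at hsg hZg
            exact hZg hsg
          · simp only [ne_eq, h, not_false_eq_true, Function.update_of_ne] at h2
            exact (hYp k hke).1 h2 ((hZp' k hke h).2 h1)

/-- The painting property. -/
theorem painting [Finite E] (M : OrientedMatroid E) (e : E) (p q : E → Prop) :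
    (∃ Z ∈ M.covectors, Z e = 1 ∧ ∀ g, g ≠ e → (Z g = 1 → p g) ∧ (Z g = -1 → q g)) ∨
    (∃ Y : E → SignType, (∀ X ∈ M.covectors, Orth X Y) ∧ Y e = 1 ∧
      ∀ g, g ≠ e → (Y g = 1 → ¬ q g) ∧ (Y g = -1 → ¬ p g)) := by
  classical
  have := Fintype.ofFinite E
  exact painting_aux e (Finset.univ.erase e) M p q (by simp)
    (fun X _ g hg hge => (hg (by simp [hge])).elim)

/-- Elimination for the sign vectors orthogonal to all covectors. -/
theorem orth_elim [Finite E] (M : OrientedMatroid E) (X Y : E → SignType)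
    (hX : ∀ W ∈ M.covectors, Orth W X) (hY : ∀ W ∈ M.covectors, Orth W Y)
    (e : E) (he : X e * Y e = -1) :
    ∃ Z : E → SignType, (∀ W ∈ M.covectors, Orth W Z) ∧ Z e = 0 ∧
      ∀ g, X g * Y g ≠ -1 → Z g = comp X Y g := by
  classical
  have := Fintype.ofFinite E
  have tri : ∀ s : SignType, s = 0 ∨ s = 1 ∨ s = -1 := by decide
  have single : ∀ f, X f * Y f ≠ -1 → comp X Y f ≠ 0 →
      ∃ Z : E → SignType, (∀ W ∈ M.covectors, Orth W Z) ∧ Z e = 0 ∧ Z f = comp X Y f ∧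
        ∀ g, X g * Y g ≠ -1 → Z g = 0 ∨ Z g = comp X Y g := by
    -- it suffices to treat the case of a positive sign at `f`
    have pos : ∀ X Y : E → SignType, (∀ W ∈ M.covectors, Orth W X) →
        (∀ W ∈ M.covectors, Orth W Y) → X e * Y e = -1 →
        ∀ f, X f * Y f ≠ -1 → comp X Y f = 1 →
        ∃ Z : E → SignType, (∀ W ∈ M.covectors, Orth W Z) ∧ Z e = 0 ∧ Z f = comp X Y f ∧
          ∀ g, X g * Y g ≠ -1 → Z g = 0 ∨ Z g = comp X Y g := by
      intro X Y hX hY he f hf hf1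
      have hfe : e ≠ f := by rintro rfl; exact hf he
      rcases M.painting f
        (fun g => g = e ∨ (X g * Y g ≠ -1 ∧ comp X Y g ≠ -1))
        (fun g => g = e ∨ (X g * Y g ≠ -1 ∧ comp X Y g ≠ 1)) with
        ⟨W, hW, hWf, hWp⟩ | ⟨Z, hZ, hZf, hZp⟩
      · exfalso
        have hWp' : ∀ g, g ≠ e →
            (W g * X g ≠ -1 ∧ W g * Y g ≠ -1) := by
          intro g hge
          by_cases hgf : g = f
          · subst hgf
            rw [hWf]
            revert hf hf1
            simp only [comp]
            generalize X g = a
            generalize Y g = b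
            revert a b
            decide
          · have h := hWp g hgf
            simp only [hge, false_or, comp] at h
            revert h
            generalize X g = a
            generalize Y g = b
            generalize W g = c
            revert a b c
            decide
        have hcase : (W e * X e ≠ -1 ∧ (W e * X e = 1 ∨ (X f = 1 ∧ W e = 0))) ∨
            (W e * Y e ≠ -1 ∧ (W e * Y e = 1 ∨ (Y f = 1 ∧ W e = 0))) := by
          have hfx : X f = 1 ∨ Y f = 1 := by
            revert hf1
            simp only [comp]
            generalize X f = a
            generalize Y f = b
            revert a b
            decide
          revert he
          generalize X e = a
          generalize Y e = b
          generalize W e = c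
          revert hfx
          generalize X f = a'
          generalize Y f = b'
          revert a' b' a b c
          decide
        rcases hcase with ⟨h1, h2⟩ | ⟨h1, h2⟩
        · have hall : ∀ g, W g * X g ≠ -1 := fun g => by
            by_cases hge : g = e
            · subst hge; exact h1
            · exact (hWp' g hge).1
          rcases h2 with h2 | ⟨h2, _⟩
          · exact not_orth e h2 hall (hX W hW)
          · exact not_orth f (by rw [hWf, h2]; rfl) hall (hX W hW)
        · have hall : ∀ g, W g * Y g ≠ -1 := fun g => by
            by_cases hge : g = e
            · subst hge; exact h1
            · exact (hWp' g hge).2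
          rcases h2 with h2 | ⟨h2, _⟩
          · exact not_orth e h2 hall (hY W hW)
          · exact not_orth f (by rw [hWf, h2]; rfl) hall (hY W hW)
      · refine ⟨Z, hZ, ?_, by rw [hZf, hf1], fun g hg => ?_⟩
        · have := hZp e hfe
          simp only [true_or, not_true_eq_false, imp_false] at this
          rcases tri (Z e) with h | h | h
          · exact h
          · exact (this.1 h).elim
          · exact (this.2 h).elim
        · by_cases hgf : g = f
          · subst hgf; right; rw [hZf, hf1]
          · have hge : g ≠ e := by rintro rfl; exact hg he
            have h := hZp g hgf
            simp only [hge, false_or] at h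
            revert h hg
            simp only [comp]
            generalize X g = a
            generalize Y g = b
            generalize Z g = c
            revert a b c
            decide
    intro f hf hf0
    rcases tri (comp X Y f) with h | h | h
    · exact (hf0 h).elim
    · exact pos X Y hX hY he f hf h
    · have hc : ∀ g, comp (-X) (-Y) g = -comp X Y g := comp_neg X Y
      have hm : ∀ g, (-X) g * (-Y) g = X g * Y g := by
        intro g
        simp only [Pi.neg_apply]
        generalize X g = a
        generalize Y g = b
        revert a b
        decide
      obtain ⟨Z, h1, h2, h3, h4⟩ := pos (-X) (-Y) (fun W hW => orth_neg (hX W hW))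
        (fun W hW => orth_neg (hY W hW)) (by rw [hm]; exact he) f (by rw [hm]; exact hf)
        (by rw [hc, h]; rfl)
      have nn : ∀ a b : SignType, a = -b → -a = b := by decide
      refine ⟨-Z, fun W hW => orth_neg (h1 W hW), by simp [h2], ?_, fun g hg => ?_⟩
      · exact nn _ _ (h3.trans (hc f))
      · rcases h4 g (by rw [hm]; exact hg) with h | h
        · left; simp [h]
        · right; exact nn _ _ (h.trans (hc g))
  have many : ∀ A : Finset E, (∀ f ∈ A, X f * Y f ≠ -1 ∧ comp X Y f ≠ 0) →
      ∃ Z : E → SignType, (∀ W ∈ M.covectors, Orth W Z) ∧ Z e = 0 ∧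
        (∀ f ∈ A, Z f = comp X Y f) ∧
        ∀ g, X g * Y g ≠ -1 → Z g = 0 ∨ Z g = comp X Y g := by
    intro A
    induction A using Finset.induction_on with
    | empty => exact fun _ => ⟨0, fun W _ => by simp [Orth], rfl, by simp, fun g _ => Or.inl rfl⟩
    | insert f A _ ih =>
      intro hA
      obtain ⟨Z, h1, h2, h3, h4⟩ := ih (fun k hk => hA k (by simp [hk]))
      obtain ⟨hf1, hf2⟩ := hA f (by simp)
      obtain ⟨Z', h1', h2', h3', h4'⟩ := single f hf1 hf2
      refine ⟨comp Z Z', fun W hW => orth_comp (h1 W hW) (h1' W hW), by simp [comp, h2, h2'],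
        fun k hk => ?_, fun g hg => ?_⟩
      · rcases Finset.mem_insert.1 hk with rfl | hk
        · rcases h4 k hf1 with h | h
          · rw [comp, if_pos h, h3']
          · rw [comp, if_neg (by rw [h]; exact hf2), h]
        · have hk0 := (hA k (by simp [hk])).2
          rw [comp, if_neg (by rw [h3 k hk]; exact hk0), h3 k hk]
      · rcases h4 g hg with h | h
        · rw [comp, if_pos h]
          exact h4' g hg
        · by_cases h0 : Z g = 0
          · rw [comp, if_pos h0]
            exact h4' g hg
          · rw [comp, if_neg h0]
            exact Or.inr h
  obtain ⟨Z, h1, h2, h3, h4⟩ := many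
    (Finset.univ.filter fun f => X f * Y f ≠ -1 ∧ comp X Y f ≠ 0) (by simp)
  refine ⟨Z, h1, h2, fun g hg => ?_⟩
  by_cases h0 : comp X Y g = 0
  · rcases h4 g hg with h | h
    · rw [h, h0]
    · exact h
  · exact h3 g (by simpa using ⟨hg, h0⟩)

/-- The dual oriented matroid: its covectors (the vectors of `M`) are the sign vectors
orthogonal to all covectors of `M`. -/
def dual [Finite E] (M : OrientedMatroid E) : OrientedMatroid E where
  covectors := {Y | ∀ X ∈ M.covectors, Orth X Y}
  zero_mem := fun X _ => by simp [Orth]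
  neg_mem := fun Y hY X hX => orth_neg (hY X hX)
  comp_mem := fun Y hY Z hZ X hX => orth_comp (hY X hX) (hZ X hX)
  elim := fun Y hY Z hZ e he => M.orth_elim Y Z hY hZ e he

/-- The signed cocircuits: the nonzero covectors of minimal support. -/
def cocircuits (M : OrientedMatroid E) : Set (E → SignType) :=
  {C | C ∈ M.covectors ∧ C ≠ 0 ∧
    ∀ X ∈ M.covectors, X ≠ 0 → Function.support X ⊆ Function.support C →
      Function.support X = Function.support C}

/-- The signed circuits, that is, the signed cocircuits of the dual. -/
def circuits [Finite E] (M : OrientedMatroid E) : Set (E → SignType) :=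
  M.dual.cocircuits

/-- The reorientation of `M` at the element `f`: all signs at `f` are reversed. -/
def reorient [DecidableEq E] (M : OrientedMatroid E) (f : E) : OrientedMatroid E where
  covectors := {X | Function.update X f (-X f) ∈ M.covectors}
  zero_mem := by
    have : Function.update (0 : E → SignType) f (-(0 : E → SignType) f) = 0 := by
      ext k; by_cases h : k = f <;> simp [h]
    simpa [this] using M.zero_mem
  neg_mem := fun X hX => by
    have : Function.update (-X) f (-(-X) f) = -Function.update X f (-X f) := by
      ext k; by_cases h : k = f <;> simp [h]
    simpa only [Set.mem_ofPred_eq, this] using M.neg_mem _ hX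
  comp_mem := fun X hX Y hY => by
    have : Function.update (comp X Y) f (-(comp X Y) f) =
        comp (Function.update X f (-X f)) (Function.update Y f (-Y f)) := by
      ext k
      by_cases h : k = f
      · subst h
        simp only [comp, Function.update_self]
        generalize X k = a
        generalize Y k = b
        revert a b
        decide
      · simp [comp, h]
    simpa only [Set.mem_ofPred_eq, this] using M.comp_mem _ hX _ hY
  elim := fun X hX Y hY e he => by
    have hm : ∀ k, Function.update X f (-X f) k * Function.update Y f (-Y f) k = X k * Y k := by
      intro k
      by_cases h : k = f
      · subst h
        simp only [Function.update_self]
        generalize X k = a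
        generalize Y k = b
        revert a b
        decide
      · simp [h]
    obtain ⟨Z, hZ, h0, h1⟩ := M.elim _ hX _ hY e (by rw [hm]; exact he)
    refine ⟨Function.update Z f (-Z f), ?_, ?_, fun g hg => ?_⟩
    · simpa using hZ
    · by_cases h : e = f
      · subst h; simp [h0]
      · simp [h, h0]
    · have h2 := h1 g (by rw [hm]; exact hg)
      by_cases h : g = f
      · subst h
        rw [Function.update_self, h2]
        simp only [comp, Function.update_self]
        generalize X g = a
        generalize Y g = b
        revert a b
        decide
      · rw [Function.update_of_ne h, h2]
        simp [comp, h]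

section Option

variable {ι : Type*}

/-- The contraction `M / f` of an oriented matroid on the ground set `Option ι`,
where `f = none`: its covectors are the covectors of `M` that vanish at `f`. -/
def contractNone (M : OrientedMatroid (Option ι)) : OrientedMatroid ι where
  covectors := {X | ∃ X' ∈ M.covectors, X' none = 0 ∧ ∀ i, X i = X' (some i)}
  zero_mem := ⟨0, M.zero_mem, rfl, fun _ => rfl⟩
  neg_mem := by
    rintro X ⟨X', h1, h2, h3⟩
    exact ⟨-X', M.neg_mem _ h1, by simp [h2], fun i => by simp [h3]⟩
  comp_mem := by
    rintro X ⟨X', h1, h2, h3⟩ Y ⟨Y', k1, k2, k3⟩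
    exact ⟨comp X' Y', M.comp_mem _ h1 _ k1, by simp [comp, h2, k2],
      fun i => by simp [comp, h3, k3]⟩
  elim := by
    rintro X ⟨X', h1, h2, h3⟩ Y ⟨Y', k1, k2, k3⟩ e he
    obtain ⟨Z, hZ, h0, hc⟩ := M.elim _ h1 _ k1 (some e) (by rw [← h3, ← k3]; exact he)
    refine ⟨fun i => Z (some i), ⟨Z, hZ, ?_, fun _ => rfl⟩, h0, fun g hg => ?_⟩
    · rw [hc none (by simp [h2])]
      simp [comp, h2, k2]
    · simp only [comp]
      rw [hc (some g) (by rw [← h3, ← k3]; exact hg)]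
      simp [comp, h3, k3]

/-- The deletion `M \ f` of an oriented matroid on the ground set `Option ι`,
where `f = none`: its covectors are the restrictions of the covectors of `M`. -/
def deleteNone (M : OrientedMatroid (Option ι)) : OrientedMatroid ι where
  covectors := {X | ∃ X' ∈ M.covectors, ∀ i, X i = X' (some i)}
  zero_mem := ⟨0, M.zero_mem, fun _ => rfl⟩
  neg_mem := by
    rintro X ⟨X', h1, h3⟩
    exact ⟨-X', M.neg_mem _ h1, fun i => by simp [h3]⟩
  comp_mem := by
    rintro X ⟨X', h1, h3⟩ Y ⟨Y', k1, k3⟩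
    exact ⟨comp X' Y', M.comp_mem _ h1 _ k1, fun i => by simp [comp, h3, k3]⟩
  elim := by
    rintro X ⟨X', h1, h3⟩ Y ⟨Y', k1, k3⟩ e he
    obtain ⟨Z, hZ, h0, hc⟩ := M.elim _ h1 _ k1 (some e) (by rw [← h3, ← k3]; exact he)
    refine ⟨fun i => Z (some i), ⟨Z, hZ, fun _ => rfl⟩, h0, fun g hg => ?_⟩
    simp only [comp]
    rw [hc (some g) (by rw [← h3, ← k3]; exact hg)]
    simp [comp, h3, k3]

/-- `(M, f)` with `f = none` is an affine oriented matroid: the distinguished element `f` is not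
a loop of `M`. -/
def IsAffine (M : OrientedMatroid (Option ι)) : Prop :=
  ∃ X ∈ M.covectors, X none ≠ 0

end Option

/-- The oriented matroid `M ∪ (-M)`: element `i` of `M` becomes `x_i = inl i`, and an
element `y_i = inr i` opposite to `x_i` is added for every `i`. -/
def double (M : OrientedMatroid E) : OrientedMatroid (E ⊕ E) where
  covectors := {X | ∃ Z ∈ M.covectors, X = Sum.elim Z (-Z)}
  zero_mem := ⟨0, M.zero_mem, by ext (_ | _) <;> simp⟩
  neg_mem := by
    rintro _ ⟨Z, hZ, rfl⟩
    exact ⟨-Z, M.neg_mem _ hZ, by ext (_ | _) <;> simp⟩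
  comp_mem := by
    rintro _ ⟨Z, hZ, rfl⟩ _ ⟨W, hW, rfl⟩
    refine ⟨comp Z W, M.comp_mem _ hZ _ hW, ?_⟩
    ext (i | i)
    · rfl
    · exact comp_neg Z W i
  elim := by
    rintro _ ⟨Z, hZ, rfl⟩ _ ⟨W, hW, rfl⟩ e he
    have hn : ∀ a b : SignType, -a * -b = a * b := by decide
    have key : ∀ i : E, Z i * W i = -1 → ∃ U ∈ M.covectors, U i = 0 ∧
        ∀ g, Z g * W g ≠ -1 → U g = comp Z W g := fun i => M.elim Z hZ W hW i
    have fin : ∀ U : E → SignType, (∀ g, Z g * W g ≠ -1 → U g = comp Z W g) →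
        ∀ g, Sum.elim Z (-Z) g * Sum.elim W (-W) g ≠ -1 →
          Sum.elim U (-U) g = comp (Sum.elim Z (-Z)) (Sum.elim W (-W)) g := by
      rintro U hU (g | g) hg
      · exact hU g (by simpa using hg)
      · have h1 : U g = comp Z W g := hU g (by simpa [hn] using hg)
        have h2 : comp (Sum.elim Z (-Z)) (Sum.elim W (-W)) (Sum.inr g) = -comp Z W g :=
          comp_neg Z W g
        rw [h2, ← h1]
        rfl
    rcases e with i | i
    · obtain ⟨U, hU, h0, h1⟩ := key i (by simpa using he)
      exact ⟨_, ⟨U, hU, rfl⟩, by simpa using h0, fin U h1⟩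
    · obtain ⟨U, hU, h0, h1⟩ := key i (by simpa [hn] using he)
      exact ⟨_, ⟨U, hU, rfl⟩, by simp [h0], fin U h1⟩

/-- The Lawrence oriented matroid (Lawrence matroid polytope) `Λ(M) = (M* ∪ (-M*))*`, on the
elements `x_i = inl i` and `y_i = inr i`. -/
def lawrence [Finite E] (M : OrientedMatroid E) : OrientedMatroid (E ⊕ E) :=
  M.dual.double.dual

/-! ### Subdivisions of oriented matroids -/

/-- `F` is a (possibly improper) face of the restriction of `M` to `σ`: the zero set in `σ` of a
covector that is nonnegative on `σ`. -/
def IsFace (M : OrientedMatroid E) (σ F : Set E) : Prop :=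
  ∃ X ∈ M.covectors, (∀ e ∈ σ, 0 ≤ X e) ∧ F = {e ∈ σ | X e = 0}

/-- `F` is a facet, i.e. a maximal proper face, of the restriction of `M` to `σ`. -/
def IsFacet (M : OrientedMatroid E) (σ F : Set E) : Prop :=
  Maximal (fun G => M.IsFace σ G ∧ G ≠ σ) F

/-- `σ` is spanning in `M`, i.e. it has full rank: only the zero covector vanishes on `σ`. -/
def IsSpanning (M : OrientedMatroid E) (σ : Set E) : Prop :=
  ∀ X ∈ M.covectors, (∀ e ∈ σ, X e = 0) → X = 0

/-- In the single-element extension `N` of an oriented matroid on `E` by the new point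
`p = none`, the point `p` lies in the convex hull of `σ ⊆ E`: there is a signed circuit
whose negative part is `{p}` and whose positive part is contained in `σ`. -/
def InConv [Finite E] (N : OrientedMatroid (Option E)) (σ : Set E) : Prop :=
  ∃ C ∈ N.circuits, C none = -1 ∧ ∀ e, C (some e) ≠ 0 → C (some e) = 1 ∧ e ∈ σ

/-- `S` is the set of maximal cells of a subdivision of the oriented matroid `M`. -/
structure IsSubdivision [Finite E] (M : OrientedMatroid E) (S : Set (Set E)) : Prop where
  nonempty : S.Nonempty
  /-- Maximal cells have full rank. -/
  spanning : ∀ σ ∈ S, M.IsSpanning σ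
  /-- Two cells intersect in a common face. -/
  inter_face : ∀ σ ∈ S, ∀ τ ∈ S, M.IsFace σ (σ ∩ τ) ∧ M.IsFace τ (σ ∩ τ)
  /-- Two cells intersect properly: in every single-element extension of `M`, if the new point is
  in the convex hulls of both cells, then it is in the convex hull of their intersection. -/
  inter_conv : ∀ σ ∈ S, ∀ τ ∈ S, ∀ N : OrientedMatroid (Option E), N.deleteNone = M →
    N.InConv σ → N.InConv τ → N.InConv (σ ∩ τ)
  /-- A facet of a cell lies in a facet of `M` or is a facet of precisely one other cell. -/
  facet : ∀ σ ∈ S, ∀ F, M.IsFacet σ F →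
    (∃ G, M.IsFacet Set.univ G ∧ F ⊆ G) ∨ (∃! τ, τ ∈ S ∧ τ ≠ σ ∧ M.IsFacet τ F)

/-- The sets `{i : i ∉ C⁺}`, where `C` runs over the positive cocircuits of `N` with `f ∈ C⁺`;
here `f = none`. -/
def liftingCells (N : OrientedMatroid (Option E)) : Set (Set E) :=
  {σ | ∃ C ∈ N.cocircuits, (∀ e, 0 ≤ C e) ∧ C none = 1 ∧ σ = {i | C (some i) ≠ 1}}

/-- `S` is (the set of maximal cells of) a lifting subdivision of `M`: a subdivision of `M`
whose maximal cells are obtained from an affine oriented matroid `(N, f)` with `N / f = M`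
such that `f` belongs to some positive cocircuit of `N`. -/
def IsLiftingSubdivision [Finite E] (M : OrientedMatroid E) (S : Set (Set E)) : Prop :=
  M.IsSubdivision S ∧ ∃ N : OrientedMatroid (Option E), N.contractNone = M ∧
    (∃ C ∈ N.cocircuits, (∀ e, 0 ≤ C e) ∧ C none = 1) ∧ S = N.liftingCells

/-- The maximal cells `{x_i : i ∉ C⁺} ∪ {y_i : i ∉ C⁻}` of `S(M, f)`, where `C` runs over all
cocircuits of `M` with `f ∈ C⁺`; here `f = none`, `x_i = inl i`, `y_i = inr i`. -/
def lawrenceCells {ι : Type*} (M : OrientedMatroid (Option ι)) : Set (Set (ι ⊕ ι)) :=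
  {σ | ∃ C ∈ M.cocircuits, C none = 1 ∧
    σ = Sum.inl '' {i | C (some i) ≠ 1} ∪ Sum.inr '' {i | C (some i) ≠ -1}}

end OrientedMatroid

/-- The simplicial complex on the vertex set `V` generated by the given facets. Simplicial
complexes on a finite vertex set `V` are families of subsets of `V` closed under taking subsets
(the void complex with no faces at all is allowed). -/
def complexOf {V : Type*} (facets : Set (Set V)) : LowerSet (Set V) :=
  lowerClosure facets

/-- The Alexander dual `{V \ σ : σ ∉ K}` of a simplicial complex `K`. -/
def alexanderDual {V : Type*} (K : LowerSet (Set V)) : LowerSet (Set V) where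
  carrier := {τ | ∃ σ : Set V, σ ∉ K ∧ τ = σᶜ}
  lower' := by
    rintro τ ρ hρ ⟨σ, hσ, rfl⟩
    refine ⟨ρᶜ, fun h => hσ (K.lower ?_ h), (compl_compl ρ).symm⟩
    exact Set.subset_compl_comm.1 hρ

/-!
The proof rests on two facts about oriented matroids, neither of which needs a rank function.

*Any lifting defines a subdivision* (`isSubdivision_liftingCells`). Let `N` have positive
cocircuits `C`, `D` through `f`. Eliminating `f` between `D` and `-C` gives a covector of `N / f`
that equals `D` on the cell of `C` and `-C` on the cell of `D` (`exists_separating`). Thus it cuts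
out the common face of both cells, and its sign at a point in both convex hulls is zero, which puts
that point in the hull of the common face. For the condition on facets, the covectors of `N / f`
vanishing on a facet `F` of a cell are `0, X, -X` for a single `X` (`IsFacet.exists_forall_eq`), so
two different cells with facet `F` lie on opposite sides of `X` and at most two cells can share
`F`. A second cell exists unless `F` lies on the boundary: the positive covectors that vanish on `F`
form an arc, with `C` at one end, and the other end is found as a covector of minimal support
(`exists_adjacent_cocircuit`).

*The Lawrence cells come from a lifting.* Adjoin to `M*` an opposite `y_i` of each `i ≠ f`, and
dualize (`lawrenceLift`). The contraction by `f` is `Λ(M / f)`, because `(M / f)* = M* \ f`. The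
positive cocircuits through `f` are the vectors obtained from cocircuits `C` of `M` with `f ∈ C⁺` by
putting `C⁺` on the `x_i` and `C⁻` on the `y_i` (`mem_cocircuits_lawrenceLift_iff`).

Alexander duality is the painting property of `M`. A set `σ` is a face of `S(M, f)` if and only if
some covector that is positive at `f` avoids the signs prescribed by `σ`. If there is none, painting
yields a vector of `M` positive at `f` and compatible with the complementary condition; up to sign
and reorientation of `f`, it shows that the complement of `σ` is a face of the dual complex.
Orthogonality excludes that both happen.

The basic tool is elimination repeated until the first sign vanishes
(`exists_conformal_of_separated`); it also provides a cocircuit conformal to a given covector, so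
that covectors may take the place of cocircuits.
-/

namespace OrientedMatroid

open SignVec

variable {E : Type*}

/-! ### Elimination and cocircuits -/

/-- Repeated elimination. If `Y` is supported inside the support of `X` (all within `T`) and
disagrees with `X` somewhere on `T`, then moving from `X` in the direction of `Y` until the first
sign vanishes gives a covector that on `T` is obtained from `X` by setting some of the separating
elements to zero. -/
theorem exists_conformal_of_separated [Finite E] (M : OrientedMatroid E) (T : Set E)
    {X : E → SignType} (hX : X ∈ M.covectors) :
    ∀ Y ∈ M.covectors, (∀ g ∈ T, X g = 0 → Y g = 0) → (∃ e ∈ T, X e * Y e = -1) →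
      ∃ Z ∈ M.covectors, (∃ e ∈ T, X e * Y e = -1 ∧ Z e = 0) ∧
        (∀ g ∈ T, Z g = 0 ∨ Z g = X g) ∧ ∀ g ∈ T, X g * Y g ≠ -1 → Z g = X g := by
  intro Y
  -- the induction is on the number of separating elements in `T`
  induction hn : {g ∈ T | X g * Y g = -1}.ncard using Nat.strong_induction_on generalizing Y with
  | _ n ih =>
    rintro hY hsupp ⟨e, heT, he⟩
    obtain ⟨Y', hY', hY'e, hY'c⟩ := M.elim X hX Y hY e he
    have hoff : ∀ g ∈ T, X g * Y g ≠ -1 → Y' g = X g := by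
      intro g hg h
      rw [hY'c g h, comp]
      split_ifs with h0
      · rw [h0, hsupp g hg h0]
      · rfl
    have hsub : ∀ g ∈ T, X g * Y' g = -1 → X g * Y g = -1 := by
      intro g hg h
      by_contra hne
      rw [hoff g hg hne] at h
      generalize X g = a at h
      revert a
      decide
    by_cases hsep : ∃ e' ∈ T, X e' * Y' e' = -1
    · have hlt : {g ∈ T | X g * Y' g = -1}.ncard < n := by
        rw [← hn]
        refine Set.ncard_lt_ncard ⟨fun g hg => ⟨hg.1, hsub g hg.1 hg.2⟩, fun h => ?_⟩
          (Set.toFinite _)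
        have := (h ⟨heT, he⟩).2
        rw [hY'e, mul_zero] at this
        exact absurd this (by decide)
      obtain ⟨Z, hZ, ⟨e', h1, h2, h3⟩, hZc, hZo⟩ := ih _ hlt Y' rfl hY' (fun g hg h0 => by
        rw [hoff g hg (by simp [h0]), h0]) hsep
      exact ⟨Z, hZ, ⟨e', h1, hsub e' h1 h2, h3⟩, hZc,
        fun g hg h => hZo g hg fun h' => h (hsub g hg h')⟩
    · push Not at hsep
      refine ⟨Y', hY', ⟨e, heT, he, hY'e⟩, fun g hg => ?_, hoff⟩
      by_cases h : X g * Y g = -1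
      · have h' := hsep g hg
        revert h h'
        generalize X g = a
        generalize Y g = b
        generalize Y' g = c
        revert a b c
        decide
      · exact Or.inr (hoff g hg h)

/-- Two covectors that agree and do not vanish at `e` are equal, provided that nothing is left
after eliminating `e` from their difference. -/
theorem eq_of_forall_eq_zero (M : OrientedMatroid E) {X Y : E → SignType}
    (hX : X ∈ M.covectors) (hY : Y ∈ M.covectors) {e : E} (he : X e = Y e) (he0 : X e ≠ 0)
    (h : ∀ Z ∈ M.covectors, Z e = 0 → (∀ g, X g = 0 → Y g = 0 → Z g = 0) → Z = 0) :
    X = Y := by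
  have hneg : X e * (-Y) e = -1 := by
    rw [Pi.neg_apply, ← he]
    revert he0
    generalize X e = a
    revert a
    decide
  obtain ⟨Z, hZ, hZe, hZc⟩ := M.elim X hX (-Y) (M.neg_mem Y hY) e hneg
  have hZ0 : Z = 0 := by
    refine h Z hZ hZe fun g h1 h2 => ?_
    rw [hZc g (by simp [h1])]
    simp [comp, h1, h2]
  ext g
  have := hZc g
  rw [hZ0] at this
  simp only [comp, Pi.neg_apply, Pi.zero_apply] at this
  revert this
  generalize X g = a
  generalize Y g = b
  revert a b
  decide

/-- A cocircuit is determined by its sign at one element of its support. -/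
theorem eq_of_mem_cocircuits (M : OrientedMatroid E) {C X : E → SignType}
    (hC : C ∈ M.cocircuits) (hX : X ∈ M.covectors) {e : E} (he : X e = C e) (he0 : C e ≠ 0)
    (hsupp : ∀ g, C g = 0 → X g = 0) : X = C := by
  refine (M.eq_of_forall_eq_zero hC.1 hX he.symm he0 fun Z hZ hZe h => ?_).symm
  by_contra hZ0
  have := hC.2.2 Z hZ hZ0 fun g hg hCg => hg (h g hCg (hsupp g hCg))
  exact (this ▸ (show e ∈ Function.support C from he0) : e ∈ Function.support Z) hZe

/-- A covector that is not a cocircuit can be made strictly smaller, keeping its sign at a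
prescribed element of its support. -/
theorem exists_conformal_of_notMem_cocircuits [Finite E] (M : OrientedMatroid E)
    {X : E → SignType} (hX : X ∈ M.covectors) {e : E} (he : X e ≠ 0) (hC : X ∉ M.cocircuits) :
    ∃ Z ∈ M.covectors, Z e = X e ∧ (∀ g, Z g = 0 ∨ Z g = X g) ∧ ∃ g, X g ≠ 0 ∧ Z g = 0 := by
  have hex : ∃ Y ∈ M.covectors, Y ≠ 0 ∧ Function.support Y ⊆ Function.support X ∧
      Function.support Y ≠ Function.support X := by
    by_contra hcon
    push Not at hcon
    exact hC ⟨hX, fun h => he (by simp [h]), hcon⟩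
  obtain ⟨Y, hY, hY0, hsub, hne⟩ := hex
  -- one of `Y` and `-Y` either disagrees with `X` away from `e`, or is itself the desired covector
  have main : ∀ Y ∈ M.covectors, Function.support Y ⊆ Function.support X →
      Function.support Y ≠ Function.support X → X e * Y e ≠ -1 →
      (Y e = 0 → ∃ g, X g * Y g = -1) → ∃ Z ∈ M.covectors, Z e = X e ∧
        (∀ g, Z g = 0 ∨ Z g = X g) ∧ ∃ g, X g ≠ 0 ∧ Z g = 0 := by
    intro Y hY hsub hne hYe hY0
    have hsub' : ∀ g, X g = 0 → Y g = 0 := fun g hg => by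
      by_contra h
      exact hsub h hg
    by_cases hsep : ∃ g, X g * Y g = -1
    · obtain ⟨Z, hZ, ⟨k, -, hk, hk0⟩, hZc, hZo⟩ := M.exists_conformal_of_separated Set.univ hX Y hY
        (fun g _ => hsub' g) (by simpa using hsep)
      exact ⟨Z, hZ, hZo e trivial hYe, fun g => hZc g trivial, k,
        fun h => by simp [h] at hk, hk0⟩
    · have hconf : ∀ g, Y g = 0 ∨ Y g = X g := by
        intro g
        have h1 := hsub' g
        have h2 := fun h => hsep ⟨g, h⟩
        revert h1 h2
        generalize X g = a
        generalize Y g = b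
        revert a b
        decide
      refine ⟨Y, hY, (hconf e).resolve_left fun h => hsep (hY0 h), hconf, ?_⟩
      by_contra hcon
      push Not at hcon
      exact hne (hsub.antisymm fun g hg => hcon g hg)
  have hsupp : Function.support (-Y) = Function.support Y := by ext; simp
  obtain ⟨k, hk⟩ := Function.ne_iff.1 hY0
  have hXk : X k ≠ 0 := hsub hk
  have aux : ∀ a b : SignType, a ≠ 0 → b ≠ 0 → a * b = -1 ∨ a * -b = -1 := by decide
  have aux' : ∀ a b : SignType, a * b ≠ -1 ∨ a * -b ≠ -1 := by decide
  by_cases hYe : Y e = 0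
  · rcases aux _ _ hXk hk with h | h
    · exact main Y hY hsub hne (by simp [hYe]) fun _ => ⟨k, h⟩
    · exact main (-Y) (M.neg_mem Y hY) (hsupp ▸ hsub) (hsupp ▸ hne) (by simp [hYe])
        fun _ => ⟨k, h⟩
  · rcases aux' (X e) (Y e) with h | h
    · exact main Y hY hsub hne h fun h => absurd h hYe
    · exact main (-Y) (M.neg_mem Y hY) (hsupp ▸ hsub) (hsupp ▸ hne) h
        fun h => absurd (by simpa using h) hYe

/-- Every covector conforms to a cocircuit through a prescribed element of its support. -/
theorem exists_cocircuit_conformal [Finite E] (M : OrientedMatroid E) (e : E) :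
    ∀ X ∈ M.covectors, X e ≠ 0 → ∃ C ∈ M.cocircuits, C e = X e ∧ ∀ g, C g = 0 ∨ C g = X g := by
  intro X
  induction hn : (Function.support X).ncard using Nat.strong_induction_on generalizing X with
  | _ n ih =>
    intro hX he
    by_cases hC : X ∈ M.cocircuits
    · exact ⟨X, hC, rfl, fun _ => Or.inr rfl⟩
    obtain ⟨Z, hZ, hZe, hZc, k, hk, hk0⟩ := M.exists_conformal_of_notMem_cocircuits hX he hC
    have hlt : (Function.support Z).ncard < n := by
      rw [← hn]
      exact Set.ncard_lt_ncard ⟨fun g hg => by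
        rw [Function.mem_support, ← (hZc g).resolve_left hg]; exact hg,
        fun h => h (a := k) hk hk0⟩ (Set.toFinite _)
    obtain ⟨C, hC, hCe, hCc⟩ := ih _ hlt Z rfl hZ (hZe ▸ he)
    refine ⟨C, hC, hCe.trans hZe, fun g => ?_⟩
    rcases hCc g with h | h
    · exact Or.inl h
    · rw [h]; exact hZc g

/-- A sign vector orthogonal to all vectors of `M` is a covector: `M** = M`. -/
theorem mem_covectors_of_forall_orth [Finite E] (M : OrientedMatroid E) {X : E → SignType}
    (hX : ∀ Y ∈ M.dual.covectors, Orth Y X) : X ∈ M.covectors := by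
  classical
  have := Fintype.ofFinite E
  have nn : ∀ a b : SignType, a = -b → -a = b := by decide
  have pos : ∀ X : E → SignType, (∀ Y ∈ M.dual.covectors, Orth Y X) → ∀ e, X e = 1 →
      ∃ Z ∈ M.covectors, Z e = X e ∧ ∀ g, Z g = 0 ∨ Z g = X g := by
    intro X hX e he
    rcases M.painting e (fun g => X g = 1) (fun g => X g = -1) with
      ⟨Z, hZ, hZe, hZp⟩ | ⟨Y, hY, hYe, hYp⟩
    · refine ⟨Z, hZ, hZe.trans he.symm, fun g => ?_⟩
      by_cases hg : g = e
      · subst hg; right; rw [hZe, he]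
      · have := hZp g hg
        revert this
        generalize X g = a
        generalize Z g = b
        revert a b
        decide
    · refine (not_orth e (by rw [hYe, he]; rfl) (fun g => ?_) (hX Y hY)).elim
      by_cases hg : g = e
      · subst hg; rw [hYe, he]; decide
      · have := hYp g hg
        revert this
        generalize X g = a
        generalize Y g = b
        revert a b
        decide
  have single : ∀ e, ∃ Z ∈ M.covectors, Z e = X e ∧ ∀ g, Z g = 0 ∨ Z g = X g := by
    intro e
    have tri : ∀ s : SignType, s = 0 ∨ s = 1 ∨ s = -1 := by decide
    rcases tri (X e) with h | h | h
    · exact ⟨0, M.zero_mem, h.symm, fun _ => Or.inl rfl⟩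
    · exact pos X hX e h
    · obtain ⟨Z, hZ, h1, h2⟩ := pos (-X) (fun Y hY => orth_neg (hX Y hY)) e (by simp [h])
      refine ⟨-Z, M.neg_mem Z hZ, nn _ _ h1, fun g => ?_⟩
      rcases h2 g with h | h
      · left; simp [h]
      · right; exact nn _ _ h
  have many : ∀ A : Finset E, ∃ Z ∈ M.covectors, (∀ e ∈ A, Z e = X e) ∧
      ∀ g, Z g = 0 ∨ Z g = X g := by
    intro A
    induction A using Finset.induction_on with
    | empty => exact ⟨0, M.zero_mem, by simp, fun _ => Or.inl rfl⟩
    | insert f A _ ih =>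
      obtain ⟨Z, hZ, h1, h2⟩ := ih
      obtain ⟨W, hW, h3, h4⟩ := single f
      have hcases : ∀ g, (Z g = X g ∨ W g = X g) → comp Z W g = X g := by
        intro g h
        have h5 := h2 g
        have h6 := h4 g
        simp only [comp]
        revert h h5 h6
        generalize X g = a
        generalize Z g = b
        generalize W g = c
        revert a b c
        decide
      refine ⟨comp Z W, M.comp_mem Z hZ W hW, fun k hk => hcases k ?_, fun g => ?_⟩
      · rcases Finset.mem_insert.1 hk with rfl | hk
        · exact Or.inr h3
        · exact Or.inl (h1 k hk)
      · rcases h2 g with h | h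
        · rw [comp, if_pos h]; exact h4 g
        · exact Or.inr (hcases g (Or.inl h))
  obtain ⟨Z, hZ, h, -⟩ := many Finset.univ
  rwa [show X = Z from funext fun e => (h e (Finset.mem_univ e)).symm]

/-! ### Faces -/

/-- The span of a facet of a full-dimensional cell is a hyperplane: up to sign, there is only one
nonzero covector vanishing on it. -/
theorem IsFacet.exists_forall_eq [Finite E] {M : OrientedMatroid E} {σ F : Set E}
    (hσ : M.IsSpanning σ) (hF : M.IsFacet σ F) :
    ∃ X ∈ M.covectors, ∀ Y ∈ M.covectors, (∀ e ∈ F, Y e = 0) → Y = 0 ∨ Y = X ∨ Y = -X := by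
  obtain ⟨⟨⟨X, hX, hpos, hFX⟩, hne⟩, hmax⟩ := hF
  have hXpos : ∀ e ∈ σ, e ∉ F → X e = 1 := by
    intro e he heF
    have h1 := hpos e he
    have h2 : X e ≠ 0 := fun h => heF (hFX ▸ ⟨he, h⟩)
    revert h1 h2
    generalize X e = a
    revert a
    decide
  have hX0 : ∀ e ∈ F, X e = 0 := fun e he => (hFX ▸ he : e ∈ {e ∈ σ | X e = 0}).2
  have hFσ : F ⊆ σ := fun e he => (hFX ▸ he : e ∈ {e ∈ σ | X e = 0}).1
  obtain ⟨k, hkσ, hkF⟩ : ∃ k ∈ σ, k ∉ F := Set.exists_of_ssubset (hFσ.ssubset_of_ne hne)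
  -- otherwise moving from `X` towards `Y` would produce a larger proper face
  have mixed : ∀ Y ∈ M.covectors, (∀ e ∈ F, Y e = 0) → ∀ e ∈ σ, e ∉ F → Y e = -1 →
      ∀ g ∈ σ, g ∉ F → Y g = -1 := by
    intro Y hY hYF e he heF hYe g hg hgF
    by_contra hYg
    obtain ⟨Z, hZ, ⟨e', he', hs, hZe'⟩, hZc, hZo⟩ := M.exists_conformal_of_separated σ hX Y hY
      (fun g hg h0 => hYF g (hFX ▸ ⟨hg, h0⟩)) ⟨e, he, by rw [hXpos e he heF, hYe]; rfl⟩
    have hZg : Z g = 1 := by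
      rw [hZo g hg (by rw [hXpos g hg hgF, one_mul]; exact hYg), hXpos g hg hgF]
    have hface : M.IsFace σ {e ∈ σ | Z e = 0} :=
      ⟨Z, hZ, fun e he => by rcases hZc e he with h | h <;> rw [h]; exact hpos e he, rfl⟩
    have hle := hmax ⟨hface, fun h => by
      have := (h.ge hg).2
      rw [hZg] at this
      exact absurd this (by decide)⟩ (fun a ha => ⟨hFσ ha, by
        rcases hZc a (hFσ ha) with h | h
        · exact h
        · rw [h, hX0 a ha]⟩)
    have := hX0 e' (hle ⟨he', hZe'⟩)
    rw [this, zero_mul] at hs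
    exact absurd hs (by decide)
  have key : ∀ Y ∈ M.covectors, (∀ e ∈ F, Y e = 0) → Y k = 0 → Y = 0 := by
    intro Y hY hYF hYk
    refine hσ Y hY fun e he => ?_
    by_cases heF : e ∈ F
    · exact hYF e heF
    have h1 : Y e ≠ -1 := fun h => by
      have := mixed Y hY hYF e he heF h k hkσ hkF
      rw [hYk] at this
      exact absurd this (by decide)
    have h2 : -Y e ≠ -1 := fun h => by
      have := mixed (-Y) (M.neg_mem Y hY) (fun e he => by simp [hYF e he]) e he heF h k hkσ hkF
      rw [Pi.neg_apply, hYk] at this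
      exact absurd this (by decide)
    revert h1 h2
    generalize Y e = a
    revert a
    decide
  have agree : ∀ Y ∈ M.covectors, (∀ e ∈ F, Y e = 0) → Y k = 1 → X = Y := by
    intro Y hY hYF hYk
    exact M.eq_of_forall_eq_zero hX hY (e := k) (by rw [hXpos k hkσ hkF, hYk])
      (by rw [hXpos k hkσ hkF]; decide)
      fun Z hZ hZk h => key Z hZ (fun e he => h e (hX0 e he) (hYF e he)) hZk
  refine ⟨X, hX, fun Y hY hYF => ?_⟩
  have tri : ∀ s : SignType, s = 0 ∨ s = 1 ∨ s = -1 := by decide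
  rcases tri (Y k) with h | h | h
  · exact Or.inl (key Y hY hYF h)
  · exact Or.inr (Or.inl (agree Y hY hYF h).symm)
  · refine Or.inr (Or.inr ?_)
    rw [agree (-Y) (M.neg_mem Y hY) (fun e he => by simp [hYF e he]) (by simp [h]), neg_neg]

theorem exists_isFacet_of_isFace [Finite E] {M : OrientedMatroid E} {σ F : Set E}
    (hF : M.IsFace σ F) (hne : F ≠ σ) : ∃ G, M.IsFacet σ G ∧ F ⊆ G := by
  obtain ⟨G, hFG, hG⟩ := (Set.toFinite {G | M.IsFace σ G ∧ G ≠ σ}).exists_le_maximal ⟨hF, hne⟩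
  exact ⟨G, hG, hFG⟩

/-! ### Lifting subdivisions -/

theorem mem_contractNone_of_none_eq_zero (N : OrientedMatroid (Option E))
    {X : Option E → SignType} (hX : X ∈ N.covectors) (h0 : X none = 0) :
    (fun i => X (some i)) ∈ N.contractNone.covectors :=
  ⟨X, hX, h0, fun _ => rfl⟩

/-- The zero set, off the distinguished element `none`, of a sign vector. -/
def zeroCell (C : Option E → SignType) : Set E :=
  {i | C (some i) = 0}

theorem mem_liftingCells_iff (N : OrientedMatroid (Option E)) (σ : Set E) :
    σ ∈ N.liftingCells ↔
      ∃ C ∈ N.cocircuits, (∀ e, 0 ≤ C e) ∧ C none = 1 ∧ σ = zeroCell C := by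
  have aux : ∀ a : SignType, 0 ≤ a → (a ≠ 1 ↔ a = 0) := by decide
  have : ∀ C : Option E → SignType, (∀ e, 0 ≤ C e) →
      {i | C (some i) ≠ 1} = zeroCell C := fun C hC =>
    Set.ext fun i => aux _ (hC (some i))
  constructor
  · rintro ⟨C, hC, hpos, h1, rfl⟩
    exact ⟨C, hC, hpos, h1, this C hpos⟩
  · rintro ⟨C, hC, hpos, h1, rfl⟩
    exact ⟨C, hC, hpos, h1, (this C hpos).symm⟩

/-- The difference `D - C` of two covectors with the same nonzero sign at the distinguished
element: it separates the zero cells of `C` and `D`. -/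
theorem exists_separating (N : OrientedMatroid (Option E)) {C D : Option E → SignType}
    (hC : C ∈ N.covectors) (hD : D ∈ N.covectors) (hC1 : C none = 1) (hD1 : D none = 1) :
    ∃ P ∈ N.covectors, P none = 0 ∧ (∀ e, C e = 0 → P e = D e) ∧ ∀ e, D e = 0 → P e = -C e := by
  obtain ⟨P, hP, h0, hc⟩ := N.elim D hD (-C) (N.neg_mem C hC) none (by simp [hC1, hD1])
  refine ⟨P, hP, h0, fun e he => ?_, fun e he => ?_⟩
  · rw [hc e (by simp [he])]
    simp only [comp, Pi.neg_apply, he, neg_zero]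
    split_ifs with h
    · exact h.symm
    · rfl
  · rw [hc e (by simp [he])]
    simp [comp, he]

theorem isSpanning_zeroCell (N : OrientedMatroid (Option E)) {C : Option E → SignType}
    (hC : C ∈ N.cocircuits) (hC1 : C none = 1) : N.contractNone.IsSpanning (zeroCell C) := by
  rintro X ⟨X', hX', h0, hXX'⟩ hX
  by_contra hne
  have hX'0 : X' ≠ 0 := by
    rintro rfl
    exact hne (funext hXX')
  have hsub : Function.support X' ⊆ Function.support C := by
    rintro (_ | i) hi
    · exact absurd h0 hi
    · exact fun h => hi (by rw [← hXX']; exact hX i h)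
  have := hC.2.2 X' hX' hX'0 hsub
  have hmem : none ∈ Function.support C := by simp [hC1]
  rw [← this] at hmem
  exact hmem h0

theorem isFace_inter_zeroCell (N : OrientedMatroid (Option E)) {C D : Option E → SignType}
    (hC : C ∈ N.covectors) (hD : D ∈ N.covectors) (hC1 : C none = 1) (hD1 : D none = 1)
    (hDpos : ∀ e, 0 ≤ D e) :
    N.contractNone.IsFace (zeroCell C) (zeroCell C ∩ zeroCell D) := by
  obtain ⟨P, hP, hP0, hPD, -⟩ := N.exists_separating hC hD hC1 hD1
  refine ⟨_, N.mem_contractNone_of_none_eq_zero hP hP0, fun e he => ?_, ?_⟩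
  · rw [hPD _ he]; exact hDpos _
  · ext e
    refine and_congr_right fun he => ?_
    change D (some e) = 0 ↔ P (some e) = 0
    rw [hPD _ he]

/-- A covector that is nonnegative on `σ` is nonnegative at every point in the convex hull of `σ`; if
it vanishes at the point, then the point already lies in the hull of the zeros in `σ`. -/
theorem InConv.nonneg_and_inter [Finite E] {N : OrientedMatroid (Option E)} {σ τ : Set E}
    (h : N.InConv σ) {P : Option E → SignType} (hP : P ∈ N.covectors)
    (hpos : ∀ e ∈ σ, 0 ≤ P (some e)) (hτ : ∀ e ∈ σ, P (some e) = 0 → e ∈ τ) :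
    0 ≤ P none ∧ (P none ≤ 0 → N.InConv (σ ∩ τ)) := by
  obtain ⟨V, hV, hVp, hVσ⟩ := h
  have horth : Orth P V := hV.1 P hP
  have hnn : ∀ e, P (some e) * V (some e) ≠ -1 := by
    intro e
    by_cases h0 : V (some e) = 0
    · simp [h0]
    · rw [(hVσ e h0).1, mul_one]
      have := hpos e (hVσ e h0).2
      revert this
      generalize P (some e) = a
      revert a
      decide
  have hP0 : 0 ≤ P none := by
    by_contra hneg
    refine not_orth none (Y := V) ?_ ?_ horth
    · rw [hVp]
      revert hneg
      generalize P none = a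
      revert a
      decide
    · rintro (_ | e)
      · rw [hVp]
        revert hneg
        generalize P none = a
        revert a
        decide
      · exact hnn e
  refine ⟨hP0, fun hP0' => ⟨V, hV, hVp, fun e he => ⟨(hVσ e he).1, (hVσ e he).2, ?_⟩⟩⟩
  refine hτ e (hVσ e he).2 ?_
  by_contra hPe
  refine not_orth (some e) (Y := V) ?_ ?_ horth
  · rw [(hVσ e he).1, mul_one]
    have := hpos e (hVσ e he).2
    revert this hPe
    generalize P (some e) = a
    revert a
    decide
  · rintro (_ | e)
    · simp [le_antisymm hP0' hP0]
    · exact hnn e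

/-- Crossing a facet `F` of the cell of `C`: unless `F` lies on the boundary, there is another
positive cocircuit through the distinguished element whose cell contains `F`. -/
theorem exists_adjacent_cocircuit [Finite E] (N : OrientedMatroid (Option E))
    {C : Option E → SignType} (hC : C ∈ N.cocircuits) (hpos : ∀ e, 0 ≤ C e) (hC1 : C none = 1)
    {F : Set E} (hF : N.contractNone.IsFace (zeroCell C) F) (hne : F ≠ zeroCell C)
    (hb : ∀ P ∈ N.covectors, P none = 0 → (∀ e ∈ F, P (some e) = 0) → (∀ e, 0 ≤ P e) → P = 0) :
    ∃ D ∈ N.cocircuits, (∀ e, 0 ≤ D e) ∧ D none = 1 ∧ (∀ e ∈ F, D (some e) = 0) ∧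
      ∃ e, C (some e) = 0 ∧ D (some e) ≠ 0 := by
  let S : Set (Option E → SignType) := {D | D ∈ N.covectors ∧ (∀ e, 0 ≤ D e) ∧ D none = 1 ∧
    (∀ e ∈ F, D (some e) = 0) ∧ ∃ e, C (some e) = 0 ∧ D (some e) ≠ 0}
  have hS : S.Nonempty := by
    -- `C ∘ X` belongs to `S`, where `X` defines the face `F`
    obtain ⟨X, ⟨X', hX', hX0, hXX'⟩, hXpos, hFX⟩ := hF
    refine ⟨comp C X', N.comp_mem C hC.1 X' hX', ?_, by simp [comp, hC1], fun e he => ?_, ?_⟩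
    · rintro (_ | e)
      · simp [comp, hC1]
      · simp only [comp]
        split_ifs with h
        · rw [← hXX']; exact hXpos e h
        · exact hpos _
    · rw [hFX] at he
      have h1 : C (some e) = 0 := he.1
      have h2 : X e = 0 := he.2
      simp [comp, h1, ← hXX', h2]
    · by_contra hcon
      push Not at hcon
      refine hne (hFX.trans (Set.Subset.antisymm (fun e he => he.1) fun e he => ⟨he, ?_⟩))
      have h1 : C (some e) = 0 := he
      have := hcon e h1
      rwa [comp, if_pos h1, ← hXX'] at this
  obtain ⟨D, ⟨hD, hDpos, hD1, hDF, hDC⟩, hmin⟩ :=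
    (Set.toFinite S).exists_minimalFor (fun D => (Function.support D).ncard) S hS
  refine ⟨D, ?_, hDpos, hD1, hDF, hDC⟩
  -- a covector that is conformal to `D` and strictly smaller must vanish on the cell of `C`
  have small : ∀ Z ∈ N.covectors, Z none = 1 → (∀ g, Z g = 0 ∨ Z g = D g) →
      (∃ g, D g ≠ 0 ∧ Z g = 0) → ∀ e, C (some e) = 0 → Z (some e) = 0 := by
    rintro Z hZ hZ1 hZc ⟨g, hg, hg0⟩
    by_contra hcon
    push Not at hcon
    have hlt : (Function.support Z).ncard < (Function.support D).ncard :=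
      Set.ncard_lt_ncard ⟨fun g hg => by
        rw [Function.mem_support, ← (hZc g).resolve_left hg]; exact hg,
        fun h => h (a := g) hg hg0⟩ (Set.toFinite _)
    refine hlt.not_ge (hmin ⟨hZ, fun e => ?_, hZ1, fun e he => ?_, hcon⟩ hlt.le)
    · rcases hZc e with h | h <;> rw [h]
      exact hDpos e
    · rcases hZc (some e) with h | h
      · exact h
      · rw [h, hDF e he]
  by_contra hDco
  obtain ⟨Z, hZ, hZ1, hZc, hZs⟩ :=
    N.exists_conformal_of_notMem_cocircuits hD (e := none) (by simp [hD1]) hDco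
  rw [hD1] at hZ1
  have hZC : Z = C := by
    refine N.eq_of_mem_cocircuits hC hZ (e := none) (by rw [hZ1, hC1]) (by simp [hC1]) ?_
    rintro (_ | g) hg
    · simp [hC1] at hg
    · exact small Z hZ hZ1 hZc hZs g hg
  subst hZC
  -- so `C` conforms to `D`; now move from `D` away from `C`, in the direction `P`
  obtain ⟨P, hP, hP0, hPD, -⟩ := N.exists_separating hC.1 hD hC1 hD1
  obtain ⟨e, heC, heD⟩ := hDC
  have hP00 : P ≠ 0 := fun h => heD (by rw [← hPD _ heC, h]; rfl)
  have hPF : ∀ e ∈ F, P (some e) = 0 := by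
    intro e he
    obtain ⟨X, -, -, rfl⟩ := hF
    rw [hPD _ he.1, hDF e he]
  have hPsupp : ∀ g, D g = 0 → P g = 0 := by
    intro g hg
    have hCg : Z g = 0 := by
      rcases hZc g with h | h
      · exact h
      · rw [h, hg]
    rw [hPD g hCg, hg]
  have hsep : ∃ g, D g * P g = -1 := by
    by_contra hcon
    refine hP00 (hb P hP hP0 hPF fun g => ?_)
    have h1 := hPsupp g
    have h2 := fun h => hcon ⟨g, h⟩
    have h3 := hDpos g
    revert h1 h2 h3
    generalize D g = a
    generalize P g = b
    revert a b
    decide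
  obtain ⟨W, hW, ⟨g, -, hg, hg0⟩, hWc, hWo⟩ := N.exists_conformal_of_separated Set.univ hD P hP
    (fun g _ => hPsupp g) (by simpa using hsep)
  refine heD ?_
  have hWe : W (some e) = D (some e) := hWo _ trivial (by
    rw [hPD _ heC]
    generalize D (some e) = a
    revert a
    decide)
  rw [← hWe]
  exact small W hW (by rw [hWo none trivial (by rw [hP0, mul_zero]; decide), hD1])
    (fun g => hWc g trivial) ⟨g, fun h => by simp [h] at hg, hg0⟩ e heC

/-- Three distinct cells cannot share a facet. -/
theorem eq_of_isFacet_zeroCell [Finite E] (N : OrientedMatroid (Option E))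
    {C D D' : Option E → SignType} (hC : C ∈ N.cocircuits) (hD : D ∈ N.cocircuits)
    (hD' : D' ∈ N.cocircuits) (hCpos : ∀ e, 0 ≤ C e) (hDpos : ∀ e, 0 ≤ D e)
    (hDpos' : ∀ e, 0 ≤ D' e) (hC1 : C none = 1) (hD1 : D none = 1) (hD1' : D' none = 1)
    {F : Set E} (hF : N.contractNone.IsFacet (zeroCell C) F) (hFD : F ⊆ zeroCell D)
    (hFD' : F ⊆ zeroCell D') (hne : zeroCell D ≠ zeroCell C) (hne' : zeroCell D' ≠ zeroCell C) :
    D = D' := by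
  have hFC : F ⊆ zeroCell C := by
    obtain ⟨⟨⟨X, -, -, rfl⟩, -⟩, -⟩ := hF
    exact fun e he => he.1
  obtain ⟨X, hXmem, hX⟩ := hF.exists_forall_eq (N.isSpanning_zeroCell hC hC1)
  -- each pair of distinct cells lies on opposite sides of the hyperplane spanned by `F`
  have sep : ∀ A ∈ N.cocircuits, ∀ B ∈ N.cocircuits, (∀ e, 0 ≤ A e) → (∀ e, 0 ≤ B e) →
      A none = 1 → B none = 1 → F ⊆ zeroCell A → F ⊆ zeroCell B → A ≠ B →
      ((∀ e ∈ zeroCell A, 0 ≤ X e) ∧ ∀ e ∈ zeroCell B, 0 ≤ -X e) ∨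
        ((∀ e ∈ zeroCell A, 0 ≤ -X e) ∧ ∀ e ∈ zeroCell B, 0 ≤ X e) := by
    intro A hA B hB hApos hBpos hA1 hB1 hFA hFB hAB
    obtain ⟨P, hP, hP0, hPB, hPA⟩ := N.exists_separating hA.1 hB.1 hA1 hB1
    have h1 : ∀ e ∈ zeroCell A, 0 ≤ P (some e) := fun e he => by rw [hPB _ he]; exact hBpos _
    have h2 : ∀ e ∈ zeroCell B, 0 ≤ -P (some e) := fun e he => by
      rw [hPA _ he, neg_neg]; exact hApos _
    rcases hX _ (N.mem_contractNone_of_none_eq_zero hP hP0)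
      (fun e he => by rw [hPB _ (hFA he)]; exact hFB he) with h | h | h
    · refine absurd (N.eq_of_mem_cocircuits hA hB.1 (hB1.trans hA1.symm) (by simp [hA1]) ?_).symm
        hAB
      rintro (_ | e) he
      · simp [hA1] at he
      · rw [← hPB _ he]; exact congrFun h e
    · subst h
      exact Or.inl ⟨h1, h2⟩
    · have : ∀ e, X e = -P (some e) := fun e => by rw [congrFun h e, Pi.neg_apply, neg_neg]
      simp only [this, neg_neg]
      exact Or.inr ⟨h1, h2⟩
  have hX0 : X ≠ 0 := by
    rintro rfl
    obtain ⟨⟨⟨Y, hY, -, hFY⟩, hFne⟩, -⟩ := hF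
    have hY0 : Y = 0 := by
      simpa using hX Y hY fun e he => (hFY ▸ he : e ∈ {e ∈ zeroCell C | Y e = 0}).2
    exact hFne (hFY.trans (by simp [hY0]))
  have pinch : ∀ A ∈ N.cocircuits, A none = 1 → (∀ e ∈ zeroCell A, 0 ≤ X e) →
      ¬ ∀ e ∈ zeroCell A, 0 ≤ -X e := by
    intro A hA hA1 h1 h2
    refine hX0 (N.isSpanning_zeroCell hA hA1 X hXmem fun e he => ?_)
    have := h1 e he
    have := h2 e he
    revert this
    revert this
    generalize X e = a
    revert a
    decide
  by_contra hDD
  rcases sep C hC D hD hCpos hDpos hC1 hD1 hFC hFD (fun h => hne (h ▸ rfl)) with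
    ⟨hc, hd⟩ | ⟨hc, hd⟩ <;>
  rcases sep C hC D' hD' hCpos hDpos' hC1 hD1' hFC hFD' (fun h => hne' (h ▸ rfl)) with
    ⟨hc', hd'⟩ | ⟨hc', hd'⟩ <;>
  rcases sep D hD D' hD' hDpos hDpos' hD1 hD1' hFD hFD' hDD with
    ⟨hd₂, hd₂'⟩ | ⟨hd₂, hd₂'⟩ <;>
  first
  | exact pinch C hC hC1 hc hc'
  | exact pinch C hC hC1 hc' hc
  | exact pinch D hD hD1 hd hd₂
  | exact pinch D hD hD1 hd₂ hd
  | exact pinch D' hD' hD1' hd' hd₂'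
  | exact pinch D' hD' hD1' hd₂' hd'

/-- The cells defined by the positive cocircuits through the distinguished element of any
lifting form a subdivision of the contraction. -/
theorem isSubdivision_liftingCells [Finite E] (N : OrientedMatroid (Option E))
    (hN : ∃ C ∈ N.cocircuits, (∀ e, 0 ≤ C e) ∧ C none = 1) :
    N.contractNone.IsSubdivision N.liftingCells where
  nonempty := by
    obtain ⟨C, hC, hpos, hC1⟩ := hN
    exact ⟨_, C, hC, hpos, hC1, rfl⟩
  spanning σ hσ := by
    obtain ⟨C, hC, -, hC1, rfl⟩ := (N.mem_liftingCells_iff σ).1 hσ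
    exact N.isSpanning_zeroCell hC hC1
  inter_face σ hσ τ hτ := by
    obtain ⟨C, hC, hCpos, hC1, rfl⟩ := (N.mem_liftingCells_iff σ).1 hσ
    obtain ⟨D, hD, hDpos, hD1, rfl⟩ := (N.mem_liftingCells_iff τ).1 hτ
    refine ⟨N.isFace_inter_zeroCell hC.1 hD.1 hC1 hD1 hDpos, ?_⟩
    rw [Set.inter_comm]
    exact N.isFace_inter_zeroCell hD.1 hC.1 hD1 hC1 hCpos
  inter_conv σ hσ τ hτ K hK hKσ hKτ := by
    obtain ⟨C, hC, hCpos, hC1, rfl⟩ := (N.mem_liftingCells_iff σ).1 hσ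
    obtain ⟨D, hD, hDpos, hD1, rfl⟩ := (N.mem_liftingCells_iff τ).1 hτ
    obtain ⟨P, hP, hP0, hPD, hPC⟩ := N.exists_separating hC.1 hD.1 hC1 hD1
    have hPK := N.mem_contractNone_of_none_eq_zero hP hP0
    rw [← hK] at hPK
    obtain ⟨Q, hQ, hPQ⟩ := hPK
    have hQD : ∀ e ∈ zeroCell C, Q (some e) = D (some e) := fun e he =>
      (hPQ e).symm.trans (hPD _ he)
    have hQC : ∀ e ∈ zeroCell D, Q (some e) = -C (some e) := fun e he =>
      (hPQ e).symm.trans (hPC _ he)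
    have h1 := hKσ.nonneg_and_inter (τ := zeroCell D) hQ
      (fun e he => by rw [hQD e he]; exact hDpos _) (fun e he h => (hQD e he).symm.trans h)
    have h2 := hKτ.nonneg_and_inter (τ := zeroCell C) (K.neg_mem Q hQ)
      (fun e he => by rw [Pi.neg_apply, hQC e he, neg_neg]; exact hCpos _)
      (fun e he h => by rw [Pi.neg_apply, hQC e he, neg_neg] at h; exact h)
    refine h1.2 ?_
    have := h2.1
    rw [Pi.neg_apply] at this
    revert this
    generalize Q none = a
    revert a
    decide
  facet σ hσ F hF := by
    obtain ⟨C, hC, hCpos, hC1, rfl⟩ := (N.mem_liftingCells_iff σ).1 hσ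
    by_cases hb : ∀ P ∈ N.covectors, P none = 0 → (∀ e ∈ F, P (some e) = 0) →
      (∀ e, 0 ≤ P e) → P = 0
    swap
    · left
      push Not at hb
      obtain ⟨P, hP, hP0, hPF, hPpos, hPne⟩ := hb
      obtain ⟨G, hG, hFG⟩ := exists_isFacet_of_isFace (M := N.contractNone) (σ := Set.univ)
        ⟨_, N.mem_contractNone_of_none_eq_zero hP hP0, fun e _ => hPpos (some e), rfl⟩
        (fun h => hPne (by
          ext (_ | e)
          · exact hP0
          · exact (h.ge (Set.mem_univ e)).2))
      exact ⟨G, hG, fun e he => hFG ⟨trivial, hPF e he⟩⟩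
    · right
      obtain ⟨D, hD, hDpos, hD1, hDF, k, hkC, hkD⟩ :=
        N.exists_adjacent_cocircuit hC hCpos hC1 hF.prop.1 hF.prop.2 hb
      have hne : zeroCell D ≠ zeroCell C := fun h => hkD (h.ge hkC)
      have hFC : F ⊆ zeroCell C := by
        obtain ⟨⟨⟨X, -, -, rfl⟩, -⟩, -⟩ := hF
        exact fun e he => he.1
      -- the common face contains `F` and is proper, so it equals `F`
      have hFeq : zeroCell C ∩ zeroCell D = F :=
        (hF.eq_of_le ⟨N.isFace_inter_zeroCell hC.1 hD.1 hC1 hD1 hDpos,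
          fun h => hkD (h.ge hkC).2⟩ (Set.subset_inter hFC hDF)).symm
      have hface : N.contractNone.IsFace (zeroCell D) F := by
        rw [← hFeq, Set.inter_comm]
        exact N.isFace_inter_zeroCell hD.1 hC.1 hD1 hC1 hCpos
      have hFneD : F ≠ zeroCell D := by
        intro h
        have hDC : D = C := by
          refine N.eq_of_mem_cocircuits hD hC.1 (hC1.trans hD1.symm) (by simp [hD1]) ?_ |>.symm
          rintro (_ | e) he
          · simp [hD1] at he
          · exact hFC (h.ge he)
        exact hne (hDC ▸ rfl)
      have hfacet : N.contractNone.IsFacet (zeroCell D) F := by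
        -- a face between `F` and the cell is cut out by the only covector vanishing on `F`
        refine ⟨⟨hface, hFneD⟩, fun G hG hFG => ?_⟩
        obtain ⟨X, -, hX⟩ := hF.exists_forall_eq (N.isSpanning_zeroCell hC hC1)
        obtain ⟨⟨Y, hY, -, hGY⟩, hGne⟩ := hG
        obtain ⟨Z, hZ, -, hFZ⟩ := hface
        have hY0 := hX Y hY fun e he => (hGY.le (hFG he)).2
        have hZ0 := hX Z hZ fun e he => (hFZ.le he).2
        have hYne : Y ≠ 0 := fun h => hGne (hGY.trans (by simp [h]))
        have hYZ : ∀ e, Y e = 0 → Z e = 0 := by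
          intro e he
          rcases hY0.resolve_left hYne with h | h <;> rcases hZ0 with h' | h' | h' <;>
            simp_all
        intro e he
        have := hGY.le he
        exact hFZ.ge ⟨this.1, hYZ e this.2⟩
      refine ⟨zeroCell D, ⟨(N.mem_liftingCells_iff _).2 ⟨D, hD, hDpos, hD1, rfl⟩, hne, hfacet⟩, ?_⟩
      rintro τ ⟨hτ, hτne, hτF⟩
      obtain ⟨D', hD', hDpos', hD1', rfl⟩ := (N.mem_liftingCells_iff τ).1 hτ
      have hFD' : F ⊆ zeroCell D' := by
        obtain ⟨⟨⟨X, -, -, rfl⟩, -⟩, -⟩ := hτF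
        exact fun e he => he.1
      rw [N.eq_of_isFacet_zeroCell hC hD hD' hCpos hDpos hDpos' hC1 hD1 hD1' hF hDF hFD' hne hτne]

/-! ### The lifting of the Lawrence oriented matroid -/

/-- The oriented matroid on `E'` in which `e'` is a copy of `φ e'`, reoriented or made into a loop
according to the sign `s e'`. -/
def signedPullback {E' : Type*} (M : OrientedMatroid E) (φ : E' → E) (s : E' → SignType) :
    OrientedMatroid E' where
  covectors := {X | ∃ Z ∈ M.covectors, ∀ e, X e = s e * Z (φ e)}
  zero_mem := ⟨0, M.zero_mem, by simp⟩
  neg_mem := by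
    rintro X ⟨Z, hZ, h⟩
    exact ⟨-Z, M.neg_mem Z hZ, fun e => by simp [h]⟩
  comp_mem := by
    rintro X ⟨Z, hZ, hX⟩ Y ⟨W, hW, hY⟩
    refine ⟨comp Z W, M.comp_mem Z hZ W hW, fun e => ?_⟩
    simp only [comp, hX, hY]
    generalize Z (φ e) = a
    generalize W (φ e) = b
    generalize s e = c
    revert a b c
    decide
  elim := by
    rintro X ⟨Z, hZ, hX⟩ Y ⟨W, hW, hY⟩ e he
    have hsq : ∀ a b c : SignType, (c * a) * (c * b) = -1 → a * b = -1 := by decide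
    rw [hX, hY] at he
    obtain ⟨U, hU, h0, hc⟩ := M.elim Z hZ W hW (φ e) (hsq _ _ _ he)
    refine ⟨fun e => s e * U (φ e), ⟨U, hU, fun _ => rfl⟩, by simp [h0], fun g hg => ?_⟩
    have := hc (φ g)
    rw [hX, hY] at hg
    simp only [comp, hX, hY] at this ⊢
    revert this hg
    generalize Z (φ g) = a
    generalize W (φ g) = b
    generalize s g = c
    generalize U (φ g) = d
    revert a b c d
    decide

section Option

variable {ι : Type*}

/-- The map sending both `x_i` and `y_i` to `i`, and `f` to `f`. -/
def lawrenceProj : Option (ι ⊕ ι) → Option ι :=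
  Option.map (Sum.elim id id)

/-- The sign `-1` at every `y_i`, and `1` elsewhere. -/
def lawrenceSign : Option (ι ⊕ ι) → SignType
  | some (Sum.inr _) => -1
  | _ => 1

/-- The lifting of `Λ(M / f)`: the dual of the oriented matroid obtained from `M*` by adjoining
an opposite element `y_i` to every `i ≠ f`. -/
def lawrenceLift [Finite ι] (M : OrientedMatroid (Option ι)) : OrientedMatroid (Option (ι ⊕ ι)) :=
  (M.dual.signedPullback lawrenceProj lawrenceSign).dual

/-- The sign vector `(Z, -Z)` on the `x_i` and `y_i`, with the sign of `Z` at `f`. -/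
def oppositeLift (Z : Option ι → SignType) : Option (ι ⊕ ι) → SignType :=
  fun e => lawrenceSign e * Z (lawrenceProj e)

/-- The positive sign vector supported on the `x_i` with `X i = 1`, the `y_i` with `X i = -1`, and
on `f` if `X f ≠ 0`. -/
def splitLift (X : Option ι → SignType) : Option (ι ⊕ ι) → SignType
  | none => if X none = 0 then 0 else 1
  | some (Sum.inl i) => if X (some i) = 1 then 1 else 0
  | some (Sum.inr i) => if X (some i) = -1 then 1 else 0

@[simp]
theorem oppositeLift_none (Z : Option ι → SignType) : oppositeLift Z none = Z none :=
  one_mul _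

@[simp]
theorem oppositeLift_inl (Z : Option ι → SignType) (i : ι) :
    oppositeLift Z (some (Sum.inl i)) = Z (some i) :=
  one_mul _

@[simp]
theorem oppositeLift_inr (Z : Option ι → SignType) (i : ι) :
    oppositeLift Z (some (Sum.inr i)) = -Z (some i) :=
  neg_one_mul _

theorem mem_lawrenceLift [Finite ι] (M : OrientedMatroid (Option ι))
    (X : Option (ι ⊕ ι) → SignType) :
    X ∈ M.lawrenceLift.covectors ↔ ∀ Z ∈ M.dual.covectors, Orth (oppositeLift Z) X := by
  constructor
  · exact fun h Z hZ => h _ ⟨Z, hZ, fun _ => rfl⟩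
  · rintro h W ⟨Z, hZ, hW⟩
    rw [show W = oppositeLift Z from funext hW]
    exact h Z hZ

/-- The dual of a contraction is the deletion of the dual. -/
theorem mem_dual_contractNone_iff [Finite ι] (M : OrientedMatroid (Option ι))
    (Z : ι → SignType) :
    Z ∈ M.contractNone.dual.covectors ↔ ∃ W ∈ M.dual.covectors, ∀ i, Z i = W (some i) := by
  classical
  have orth_iff : ∀ X Y : Option ι → SignType, X none = 0 →
      (Orth (fun i => X (some i)) (fun i => Y (some i)) ↔ Orth X Y) := by
    intro X Y h0
    simp [Orth, Option.exists, h0]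
  constructor
  · intro h
    obtain ⟨s, hs⟩ := M.exists_update_orth none (Option.elim · 0 Z) fun X hX h0 =>
      (orth_iff X _ h0).1 (h _ (M.mem_contractNone_of_none_eq_zero hX h0))
    exact ⟨_, hs, fun i => by simp⟩
  · rintro ⟨W, hW, hZ⟩ X ⟨X', hX', h0, hX⟩
    rw [show X = fun i => X' (some i) from funext hX, show Z = fun i => W (some i) from funext hZ]
    exact (orth_iff X' W h0).2 (hW X' hX')

theorem contractNone_lawrenceLift [Finite ι] (M : OrientedMatroid (Option ι)) :
    M.lawrenceLift.contractNone = M.contractNone.lawrence := by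
  have orth_iff : ∀ (Z : ι → SignType) (W : Option ι → SignType) (X : ι ⊕ ι → SignType)
      (X' : Option (ι ⊕ ι) → SignType), (∀ i, Z i = W (some i)) → X' none = 0 →
      (∀ i, X i = X' (some i)) → (Orth (Sum.elim Z (-Z)) X ↔ Orth (oppositeLift W) X') := by
    intro Z W X X' hZ h0 hX
    simp [Orth, Option.exists, h0, hX, hZ]
  ext X
  constructor
  · rintro ⟨X', hX', h0, hX⟩ _ ⟨Z, hZ, rfl⟩
    obtain ⟨W, hW, hZW⟩ := (M.mem_dual_contractNone_iff Z).1 hZ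
    exact (orth_iff Z W X X' hZW h0 hX).2 ((M.mem_lawrenceLift X').1 hX' W hW)
  · intro h
    refine ⟨(Option.elim · 0 X), (M.mem_lawrenceLift _).2 fun W hW => ?_, rfl, fun _ => rfl⟩
    exact (orth_iff _ W X _ (fun _ => rfl) rfl fun _ => rfl).1
      (h _ ⟨_, (M.mem_dual_contractNone_iff _).2 ⟨W, hW, fun _ => rfl⟩, rfl⟩)

theorem splitLift_mem [Finite ι] (M : OrientedMatroid (Option ι)) {X : Option ι → SignType}
    (hX : X ∈ M.covectors) (hf : 0 ≤ X none) : splitLift X ∈ M.lawrenceLift.covectors := by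
  rw [mem_lawrenceLift]
  intro Z hZ
  have h := orth_symm (hZ X hX)
  have aux1 : ∀ a b : SignType, b * a = 1 ↔
      b * (if a = 1 then 1 else 0) = 1 ∨ -b * (if a = -1 then 1 else 0) = 1 := by decide
  have aux2 : ∀ a b : SignType, b * a = -1 ↔
      b * (if a = 1 then 1 else 0) = -1 ∨ -b * (if a = -1 then 1 else 0) = -1 := by decide
  have hnone : (if X none = 0 then 0 else 1) = X none := by
    revert hf
    generalize X none = a
    revert a
    decide
  unfold Orth at h ⊢
  simp only [Option.exists, aux1 (X (some _)), aux2 (X (some _)), exists_or] at h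
  simpa only [Option.exists, Sum.exists, splitLift, oppositeLift_none, oppositeLift_inl,
    oppositeLift_inr, hnone] using h

/-- The positive cocircuits of the lifting through `f` are the sign vectors `splitLift C`, where
`C` runs over the cocircuits of `M` positive at `f`. -/
theorem mem_cocircuits_lawrenceLift_iff [Finite ι] (M : OrientedMatroid (Option ι))
    (D : Option (ι ⊕ ι) → SignType) :
    (D ∈ M.lawrenceLift.cocircuits ∧ (∀ e, 0 ≤ D e) ∧ D none = 1) ↔
      ∃ C ∈ M.cocircuits, C none = 1 ∧ D = splitLift C := by
  constructor
  · rintro ⟨hD, hpos, hD1⟩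
    obtain ⟨X, hX, hX1, hXD⟩ : ∃ X ∈ M.covectors, X none = 1 ∧
        ∀ g, g ≠ none → (X g = 1 → ∃ i, g = some i ∧ D (some (Sum.inl i)) = 1) ∧
          (X g = -1 → ∃ i, g = some i ∧ D (some (Sum.inr i)) = 1) := by
      refine (M.painting none (fun g => ∃ i, g = some i ∧ D (some (Sum.inl i)) = 1)
        (fun g => ∃ i, g = some i ∧ D (some (Sum.inr i)) = 1)).resolve_right ?_
      rintro ⟨Y, hY, hY1, hYD⟩
      refine not_orth none ?_ ?_ ((M.mem_lawrenceLift D).1 hD.1 Y hY)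
      · simp [hY1, hD1]
      · rintro (_ | i | i)
        · simp [hY1, hD1]
        · have h := (hYD (some i) (by simp)).2
          have h' := hpos (some (Sum.inl i))
          simp only [Option.some.injEq, exists_eq_left'] at h
          rw [oppositeLift_inl]
          revert h h'
          generalize D (some (Sum.inl i)) = a
          generalize Y (some i) = b
          revert a b
          decide
        · have h := (hYD (some i) (by simp)).1
          have h' := hpos (some (Sum.inr i))
          simp only [Option.some.injEq, exists_eq_left'] at h
          rw [oppositeLift_inr]
          revert h h'
          generalize D (some (Sum.inr i)) = a
          generalize Y (some i) = b
          revert a b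
          decide
    obtain ⟨C, hC, hC1, hCX⟩ := M.exists_cocircuit_conformal none X hX (by simp [hX1])
    rw [hX1] at hC1
    refine ⟨C, hC, hC1, ?_⟩
    have hCD : ∀ i, (C (some i) = 1 → D (some (Sum.inl i)) = 1) ∧
        (C (some i) = -1 → D (some (Sum.inr i)) = 1) := by
      intro i
      have h := hXD (some i) (by simp)
      simp only [Option.some.injEq, exists_eq_left'] at h
      rcases hCX (some i) with h0 | h0
      · simp [h0]
      · rwa [h0]
    refine (M.lawrenceLift.eq_of_mem_cocircuits hD
      (M.splitLift_mem hC.1 (by rw [hC1]; decide)) (e := none) (by simp [splitLift, hC1, hD1])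
      (by simp [hD1]) ?_).symm
    rintro (_ | i | i) h
    · simp [hD1] at h
    · simp only [splitLift, ite_eq_right_iff]
      intro h1
      rw [(hCD i).1 h1] at h
      exact h
    · simp only [splitLift, ite_eq_right_iff]
      intro h1
      rw [(hCD i).2 h1] at h
      exact h
  · rintro ⟨C, hC, hC1, rfl⟩
    have hnn : ∀ e, 0 ≤ splitLift C e := by
      rintro (_ | i | i) <;> simp only [splitLift] <;> split_ifs <;> decide
    refine ⟨⟨M.splitLift_mem hC.1 (by rw [hC1]; decide), fun h => ?_, fun X hX hX0 hsub => ?_⟩,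
      hnn, by simp [splitLift, hC1]⟩
    · have := congrFun h none
      simp [splitLift, hC1] at this
    · -- `X` lives on at most one of `x_i`, `y_i` for each `i`, so it descends to a covector of `M`
      have hinl : ∀ i, C (some i) ≠ 1 → X (some (Sum.inl i)) = 0 := by
        intro i h
        by_contra h0
        exact hsub h0 (by simp [splitLift, h])
      have hinr : ∀ i, C (some i) ≠ -1 → X (some (Sum.inr i)) = 0 := by
        intro i h
        by_contra h0
        exact hsub h0 (by simp [splitLift, h])
      have hone : ∀ i, X (some (Sum.inl i)) = 0 ∨ X (some (Sum.inr i)) = 0 := by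
        intro i
        by_cases h : C (some i) = 1
        · exact Or.inr (hinr i (by rw [h]; decide))
        · exact Or.inl (hinl i h)
      let W : Option ι → SignType
        | none => X none
        | some i => if X (some (Sum.inl i)) = 0 then -X (some (Sum.inr i)) else X (some (Sum.inl i))
      have hW : W ∈ M.covectors := by
        refine M.mem_covectors_of_forall_orth fun Z hZ => ?_
        have h := (M.mem_lawrenceLift X).1 hX Z hZ
        have aux1 : ∀ a b z : SignType, (a = 0 ∨ b = 0) →
            (z * (if a = 0 then -b else a) = 1 ↔ z * a = 1 ∨ -z * b = 1) := by decide
        have aux2 : ∀ a b z : SignType, (a = 0 ∨ b = 0) →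
            (z * (if a = 0 then -b else a) = -1 ↔ z * a = -1 ∨ -z * b = -1) := by decide
        unfold Orth at h ⊢
        simp only [Option.exists, Sum.exists, oppositeLift_none, oppositeLift_inl,
          oppositeLift_inr] at h
        simpa only [Option.exists, W, aux1 _ _ _ (hone _), aux2 _ _ _ (hone _), exists_or] using h
      have hW0 : W ≠ 0 := by
        intro h
        refine hX0 (funext ?_)
        rintro (_ | i | i)
        · exact congrFun h none
        all_goals
          have h1 := congrFun h (some i)
          simp only [W, Pi.zero_apply] at h1 ⊢
          revert h1
          generalize X (some (Sum.inl i)) = a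
          generalize X (some (Sum.inr i)) = b
          revert a b
          decide
      have hWC : Function.support W ⊆ Function.support C := by
        rintro (_ | i) h
        · simp [hC1]
        · intro hCi
          exact h (by simp [W, hinl i (by simp [hCi]), hinr i (by simp [hCi])])
      have hsupp := hC.2.2 W hW hW0 hWC
      refine hsub.antisymm ?_
      have hWne : ∀ g, C g ≠ 0 → W g ≠ 0 := fun g hg => hsupp.ge hg
      rintro (_ | i | i) h
      · exact hWne none (by rw [hC1]; decide)
      · have hCi : C (some i) = 1 := by
          by_contra hne
          exact h (by simp [splitLift, hne])
        have := hWne (some i) (by rw [hCi]; decide)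
        simp only [W, hinr i (by rw [hCi]; decide)] at this
        exact fun h0 => this (by simp [h0])
      · have hCi : C (some i) = -1 := by
          by_contra hne
          exact h (by simp [splitLift, hne])
        have := hWne (some i) (by rw [hCi]; decide)
        simp only [W, hinl i (by rw [hCi]; decide)] at this
        exact fun h0 => this (by simp [h0])

theorem liftingCells_lawrenceLift [Finite ι] (M : OrientedMatroid (Option ι)) :
    M.lawrenceLift.liftingCells = M.lawrenceCells := by
  have hcell : ∀ C : Option ι → SignType, {e | splitLift C (some e) ≠ 1} =
      Sum.inl '' {i | C (some i) ≠ 1} ∪ Sum.inr '' {i | C (some i) ≠ -1} := by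
    intro C
    ext (i | i) <;> simp [splitLift]
  ext σ
  constructor
  · rintro ⟨D, hD, hpos, hD1, rfl⟩
    obtain ⟨C, hC, hC1, rfl⟩ := (M.mem_cocircuits_lawrenceLift_iff D).1 ⟨hD, hpos, hD1⟩
    exact ⟨C, hC, hC1, hcell C⟩
  · rintro ⟨C, hC, hC1, rfl⟩
    obtain ⟨hD, hpos, hD1⟩ := (M.mem_cocircuits_lawrenceLift_iff _).2 ⟨C, hC, hC1, rfl⟩
    exact ⟨_, hD, hpos, hD1, (hcell C).symm⟩

theorem IsAffine.exists_cocircuit [Finite ι] {M : OrientedMatroid (Option ι)} (hM : M.IsAffine) :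
    ∃ C ∈ M.cocircuits, C none = 1 := by
  obtain ⟨X, hX, hX0⟩ := hM
  have tri : ∀ s : SignType, s ≠ 0 → s = 1 ∨ -s = 1 := by decide
  rcases tri _ hX0 with h | h
  · obtain ⟨C, hC, hC1, -⟩ := M.exists_cocircuit_conformal none X hX hX0
    exact ⟨C, hC, hC1.trans h⟩
  · obtain ⟨C, hC, hC1, -⟩ :=
      M.exists_cocircuit_conformal none (-X) (M.neg_mem X hX) (by simpa using hX0)
    exact ⟨C, hC, hC1.trans h⟩

theorem IsAffine.isLiftingSubdivision_lawrenceCells [Finite ι] {M : OrientedMatroid (Option ι)}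
    (hM : M.IsAffine) : M.contractNone.lawrence.IsLiftingSubdivision M.lawrenceCells := by
  obtain ⟨C, hC, hC1⟩ := hM.exists_cocircuit
  have hex : ∃ D ∈ M.lawrenceLift.cocircuits, (∀ e, 0 ≤ D e) ∧ D none = 1 :=
    ⟨_, (M.mem_cocircuits_lawrenceLift_iff _).2 ⟨C, hC, hC1, rfl⟩⟩
  rw [← contractNone_lawrenceLift, ← liftingCells_lawrenceLift]
  exact ⟨M.lawrenceLift.isSubdivision_liftingCells hex, _, rfl, hex, rfl⟩

/-- Reorienting an element does not change the contraction by it. -/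
theorem contractNone_reorient_none [DecidableEq ι] (M : OrientedMatroid (Option ι)) :
    (M.reorient none).contractNone = M.contractNone := by
  have hupd : ∀ X : Option ι → SignType, X none = 0 → Function.update X none (-X none) = X := by
    intro X h
    simp [h]
  ext X
  constructor
  · rintro ⟨X', hX', h0, hX⟩
    exact ⟨X', hupd X' h0 ▸ hX', h0, hX⟩
  · rintro ⟨X', hX', h0, hX⟩
    exact ⟨X', show _ ∈ M.covectors by rwa [hupd X' h0], h0, hX⟩

/-! ### Alexander duality -/

/-- In the complex of the Lawrence cells, cocircuits may be replaced by arbitrary covectors. -/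
theorem mem_complexOf_lawrenceCells_iff [Finite ι] (M : OrientedMatroid (Option ι))
    (τ : Set (ι ⊕ ι)) :
    τ ∈ complexOf M.lawrenceCells ↔ ∃ X ∈ M.covectors, X none = 1 ∧
      ∀ i, (X (some i) = 1 → Sum.inl i ∉ τ) ∧ (X (some i) = -1 → Sum.inr i ∉ τ) := by
  constructor
  · rintro ⟨_, ⟨C, hC, hC1, rfl⟩, hτ⟩
    refine ⟨C, hC.1, hC1, fun i => ⟨fun h hi => ?_, fun h hi => ?_⟩⟩
    · have := hτ hi
      simp [h] at this
    · have := hτ hi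
      simp [h] at this
  · rintro ⟨X, hX, hX1, hXτ⟩
    obtain ⟨C, hC, hC1, hCX⟩ := M.exists_cocircuit_conformal none X hX (by simp [hX1])
    refine ⟨_, ⟨C, hC, hC1.trans hX1, rfl⟩, ?_⟩
    rintro (i | i) hi
    · have : C (some i) ≠ 1 := fun h =>
        (hXτ i).1 (by rw [← (hCX (some i)).resolve_left (by simp [h]), h]) hi
      simpa using this
    · have : C (some i) ≠ -1 := fun h =>
        (hXτ i).2 (by rw [← (hCX (some i)).resolve_left (by simp [h]), h]) hi
      simpa using this

/-- The painting property, read as Alexander duality: a set of vertices is a nonface precisely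
if there is a vector of `M` certifying that its complement is a face of the dual complex. -/
theorem alexanderDual_complexOf_lawrenceCells [Finite ι] [DecidableEq ι]
    (M : OrientedMatroid (Option ι)) :
    alexanderDual (complexOf M.lawrenceCells) =
      complexOf (M.dual.reorient none).lawrenceCells := by
  have hneg : ∀ s : SignType, (-s = 1 ↔ s = -1) ∧ (-s = -1 ↔ s = 1) := by decide
  ext τ
  rw [SetLike.mem_coe, SetLike.mem_coe, mem_complexOf_lawrenceCells_iff]
  change (∃ σ, σ ∉ complexOf M.lawrenceCells ∧ τ = σᶜ) ↔ _
  simp only [mem_complexOf_lawrenceCells_iff]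
  constructor
  · rintro ⟨σ, hσ, rfl⟩
    rcases M.painting none (fun g => ∀ i, g = some i → Sum.inl i ∉ σ)
      (fun g => ∀ i, g = some i → Sum.inr i ∉ σ) with ⟨Z, hZ, hZ1, hZσ⟩ | ⟨Y, hY, hY1, hYσ⟩
    · exact (hσ ⟨Z, hZ, hZ1, fun i => ⟨fun h => (hZσ (some i) (by simp)).1 h i rfl,
        fun h => (hZσ (some i) (by simp)).2 h i rfl⟩⟩).elim
    · -- `-Y`, reoriented at the distinguished element
      refine ⟨Function.update (-Y) none 1, ?_, by simp, fun i => ?_⟩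
      · have : Function.update (Function.update (-Y) none 1) none
            (-(Function.update (-Y) none 1) none) = -Y := by
          ext g
          by_cases h : g = none
          · subst h; simp [hY1]
          · simp [h]
        change _ ∈ M.dual.covectors
        rw [this]
        exact M.dual.neg_mem Y hY
      · have h := hYσ (some i) (by simp)
        simp only [Option.some.injEq, forall_eq', not_not] at h
        simp only [ne_eq, reduceCtorEq, not_false_eq_true, Function.update_of_ne, Pi.neg_apply,
          (hneg _).1, (hneg _).2, Set.mem_compl_iff, not_not]
        exact ⟨h.2, h.1⟩
  · rintro ⟨W, hW, hW1, hWτ⟩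
    refine ⟨τᶜ, ?_, (compl_compl τ).symm⟩
    rintro ⟨X, hX, hX1, hXτ⟩
    -- the product of `X` with the reoriented `W` is `-1` at `f`, and never `1`
    have horth : Orth X (-Function.update W none (-W none)) := orth_neg (hW X hX)
    refine not_orth none ?_ ?_ horth
    · simp [hX1, hW1]
    · rintro (_ | i)
      · simp [hX1, hW1]
      · have h1 := hXτ i
        have h2 := hWτ i
        simp only [Set.mem_compl_iff, not_not] at h1
        simp only [ne_eq, reduceCtorEq, not_false_eq_true, Function.update_of_ne, Pi.neg_apply]
        intro h
        have aux : ∀ a b : SignType, a * -b = -1 → (a = 1 ∧ b = 1) ∨ (a = -1 ∧ b = -1) := by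
          decide
        rcases aux _ _ h with ⟨ha, hb⟩ | ⟨ha, hb⟩
        · exact h2.1 hb (h1.1 ha)
        · exact h2.2 hb (h1.2 ha)

end Option

end OrientedMatroid

theorem alexanderDual_alexanderDual {V : Type*} (K : LowerSet (Set V)) :
    alexanderDual (alexanderDual K) = K := by
  have hmem : ∀ (K : LowerSet (Set V)) (τ : Set V), τ ∈ alexanderDual K ↔ τᶜ ∉ K := by
    intro K τ
    constructor
    · rintro ⟨σ, hσ, rfl⟩
      rwa [compl_compl]
    · exact fun h => ⟨τᶜ, h, (compl_compl τ).symm⟩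
  ext τ
  simp [hmem]

theorem mainTheorem6 {ι : Type*} [Finite ι] [DecidableEq ι]
    (M : OrientedMatroid (Option ι)) (hM : M.IsAffine) :
    M.contractNone.lawrence.IsLiftingSubdivision M.lawrenceCells ∧
    ((M.dual.reorient none).IsAffine →
      M.dual.contractNone.lawrence.IsLiftingSubdivision
        (M.dual.reorient none).lawrenceCells) ∧
    alexanderDual (complexOf M.lawrenceCells) =
      complexOf (M.dual.reorient none).lawrenceCells ∧
    alexanderDual (complexOf (M.dual.reorient none).lawrenceCells) =
      complexOf M.lawrenceCells := by
  refine ⟨hM.isLiftingSubdivision_lawrenceCells, fun h => ?_,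
    M.alexanderDual_complexOf_lawrenceCells, ?_⟩
  · rw [← M.dual.contractNone_reorient_none]
    exact h.isLiftingSubdivision_lawrenceCells
  · rw [← M.alexanderDual_complexOf_lawrenceCells, alexanderDual_alexanderDual]
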